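/- Identify $\mathbb{R}^5$ with $\mathbb{C}\times\mathbb{C}\times\mathbb{R}$ and let $$\mathbb{C}\Gamma_2=\{(z,z^2/h,h): z\in\mathbb{C},\ |z|\le 1,\ h\in[1/2,1]\}\subseteq\mathbb{R}^5 .$$ For $z=s+it$ put $\mathbf{c}(z)=(s,t,s^2-t^2,2st,1)$, $\mathbf{t}_s(z)=(1,0,2s,2t,0)$, $\mathbf{t}_t(z)=(0,1,-2t,2s,0)$, $\mathbf{n}_s(z)=(-2s,2t,1,0,0)$, $\mathbf{n}_t(z)=(-2t,-2s,0,1,0)$, $\mathbf{n}_5=(0,0,0,0,1)$. Fix $d\ge 3$. For $\rho>0$ let $\Theta_{\rho^2}=\{\theta_{\rho,z}: z\in\rho(\mathbb{Z}+i\mathbb{Z})\cap[-2,2]^2\}$, where $$\theta_{\rho,z}=\{a\mathbf{c}(z)+b_1\mathbf{t}_s(z)+b_2\mathbf{t}_t(z)+c_1\mathbf{n}_s(z)+c_2\mathbf{n}_t(z)+e\mathbf{n}_5:\ \tfrac12\le a\le 1,\ |b_i|\le d\rho,\ |c_i|,|e|\le d\rho^2\}.$$ Let $r\ge 1$. Let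 $(\chi_\theta)_{\theta\in\Theta_{r^{-2}}}$ be smooth non-negative functions on $\mathbb{R}^5$ with $\operatorname{supp}\chi_\theta\subseteq\theta$ and $\sum_\theta\chi_\theta=1$ on the closed $r^{-2}$-neighbourhood $\mathcal{N}_{r^{-2}}(\mathbb{C}\Gamma_2)$. For $f\in\mathcal{S}(\mathbb{R}^5)$ let $f_\theta=\mathcal{F}^{-1}(\chi_\theta\hat f)$, where $\hat f(\xi)=\int f(x)e^{-2\pi i x\cdot\xi}\,dx$. For $\tau\in\Theta_{s^2}$ let $$U_{\tau,r^2}=\operatorname{conv}\Big(\bigcup_{\theta\in\Theta_{r^{-2}},\,\theta\subseteq\tau}\theta^*\Big),\qquad \theta^*=\{x\in\mathbb{R}^5: |\langle x,\xi\rangle|\le 1\ \text{for all}\ \xi\in\theta\}.$$ For each $\tau$ fix a family of translates of $U_{\tau,r^2}$ that covers $\mathbb{R}^5$ and in which no point lies in more than $N$ members. Write $U\parallel U_{\tau,r^2}$ if $U$ belongs to this family, and for such $U$ let $S_Uf=\big(\sum_{\theta\in\Theta_{r^{-2}},\,\theta\subseteq\tau}|f_\theta|^2\big)^{1/2}\big|_U$.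 **Proposition.** For all $d\ge3$ and $N\in\mathbb{N}$ there is a constant $C$, depending only on $d$ and $N$, such that for all $r\ge 1$, all $(\chi_\theta)$ and all covering families as above, and all $f\in\mathcal{S}(\mathbb{R}^5)$ with $\operatorname{supp}\hat f\subseteq\mathcal{N}_{r^{-2}}(\mathbb{C}\Gamma_2)$, $$\int_{\mathbb{R}^5}\Big|\sum_{\theta\in\Theta_{r^{-2}}}|f_\theta|^2\Big|^2\,dx\ \le\ C\sum_{\substack{s=2^j/r,\ j\in\mathbb{N}_0\\ r^{-1}\le s\le 1}}\ \sum_{\tau\in\Theta_{s^2}}\ \sum_{U\parallel U_{\tau,r^2}}|U|^{-1}\,\|S_Uf\|_{L^2(U)}^4 .$$ -/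

import Mathlib

open MeasureTheory Set
open scoped ENNReal NNReal FourierTransform SchwartzMap Pointwise ContDiff

namespace ComplexCone

/-- The ambient space `ℝ⁵ ≅ ℂ × ℂ × ℝ` with its Euclidean structure. -/
abbrev E5 : Type := EuclideanSpace ℝ (Fin 5)

/-- The truncated complex cone `{(z, z² / h, h) : |z| ≤ 1, 1/2 ≤ h ≤ 1}`, where a complex number is
identified with its real and imaginary part. -/
def cone : Set E5 :=
  {p | ∃ (z : ℂ) (h : ℝ), ‖z‖ ≤ 1 ∧ 1 / 2 ≤ h ∧ h ≤ 1 ∧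
    p = !₂[z.re, z.im, (z ^ 2 / (h : ℂ)).re, (z ^ 2 / (h : ℂ)).im, h]}

/-- The central line direction `(z, z², 1)`. -/
noncomputable def cVec (z : ℂ) : E5 :=
  !₂[z.re, z.im, z.re ^ 2 - z.im ^ 2, 2 * z.re * z.im, 1]

/-- The tangential vector `(1, 2z, 0)`. -/
noncomputable def tVecS (z : ℂ) : E5 := !₂[1, 0, 2 * z.re, 2 * z.im, 0]

/-- The tangential vector `(i, 2iz, 0)`. -/
noncomputable def tVecT (z : ℂ) : E5 := !₂[0, 1, -(2 * z.im), 2 * z.re, 0]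

/-- The normal vector `(-2 z̄, 1, 0)`. -/
noncomputable def nVecS (z : ℂ) : E5 := !₂[-(2 * z.re), 2 * z.im, 1, 0, 0]

/-- The normal vector `(-2 i z̄, i, 0)`. -/
noncomputable def nVecT (z : ℂ) : E5 := !₂[-(2 * z.im), -(2 * z.re), 0, 1, 0]

/-- The normal vector `(0, 0, 1)`. -/
noncomputable def nVec5 : E5 := !₂[0, 0, 0, 0, 1]

/-- The plank at scale `δ = ρ²` over the base point `z`: length about `1` along the central line,
`d ρ` in the tangential directions and `d ρ²` in the normal directions. -/
def plank (d ρ : ℝ) (z : ℂ) : Set E5 :=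
  {ξ | ∃ a b₁ b₂ c₁ c₂ e : ℝ, 1 / 2 ≤ a ∧ a ≤ 1 ∧ |b₁| ≤ d * ρ ∧ |b₂| ≤ d * ρ ∧
    |c₁| ≤ d * ρ ^ 2 ∧ |c₂| ≤ d * ρ ^ 2 ∧ |e| ≤ d * ρ ^ 2 ∧
    ξ = a • cVec z + b₁ • tVecS z + b₂ • tVecT z + c₁ • nVecS z + c₂ • nVecT z + e • nVec5}

/-- The integer pairs `k` whose node `ρ (k₁ + i k₂)` lies in the square `[-2, 2]²`. This square
contains all `z / h` for `(z, z² / h, h)` in the cone. -/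
noncomputable def grid (ρ : ℝ) : Finset (ℤ × ℤ) :=
  Finset.Icc (-⌊2 / ρ⌋) ⌊2 / ρ⌋ ×ˢ Finset.Icc (-⌊2 / ρ⌋) ⌊2 / ρ⌋

/-- The base point `ρ (k₁ + i k₂)`. -/
noncomputable def node (ρ : ℝ) (k : ℤ × ℤ) : ℂ := ⟨ρ * k.1, ρ * k.2⟩

theorem mem_grid {ρ : ℝ} (hρ : 0 < ρ) (k : ℤ × ℤ) :
    k ∈ grid ρ ↔ |(node ρ k).re| ≤ 2 ∧ |(node ρ k).im| ≤ 2 := by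
  have key : ∀ m : ℤ, (-⌊2 / ρ⌋ ≤ m ∧ m ≤ ⌊2 / ρ⌋) ↔ |ρ * (m : ℝ)| ≤ 2 := by
    intro m
    rw [← abs_le, Int.le_floor, abs_mul, abs_of_pos hρ, le_div_iff₀ hρ, Int.cast_abs, mul_comm]
  simp only [grid, node, Finset.mem_product, Finset.mem_Icc, key]

/-- The planks of scale `r⁻²` contained in the plank of scale `s²` over `w`, listed through the
indices of their base points. -/
noncomputable def subPlanks (d r s : ℝ) (w : ℂ) : Finset (ℤ × ℤ) :=
  open Classical in (grid r⁻¹).filter fun k => plank d r⁻¹ (node r⁻¹ k) ⊆ plank d s w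

/-- The wave envelope `U_{τ, r²}`: for `τ` the plank of scale `s²` over `w`, the convex hull of the
union of the (absolute) polar sets `θ* = {x : |⟨ξ, x⟩| ≤ 1 for all ξ ∈ θ}` over the planks `θ` of
scale `r⁻²` contained in `τ`. -/
def waveEnvelope (d r s : ℝ) (w : ℂ) : Set E5 :=
  convexHull ℝ (⋃ k ∈ subPlanks d r s w, (innerₗ E5).polar (plank d r⁻¹ (node r⁻¹ k)))

/-- The translates `x + U`, `x ∈ T`, cover the space, and no point is in more than `N` of them. -/
def IsTranslateCover (N : ℕ) (U T : Set E5) : Prop :=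
  (∀ y, ∃ x ∈ T, y ∈ x +ᵥ U) ∧ ∀ y, {x ∈ T | y ∈ x +ᵥ U}.encard ≤ N

/-- A smooth partition of unity on the closed `r⁻²`-neighbourhood of the cone that is subordinate
to the planks of scale `r⁻²`. -/
structure IsPlankPartition (d r : ℝ) (χ : ℤ × ℤ → E5 → ℝ) : Prop where
  smooth : ∀ k ∈ grid r⁻¹, ContDiff ℝ ∞ (χ k)
  nonneg : ∀ k ∈ grid r⁻¹, ∀ ξ, 0 ≤ χ k ξ
  tsupport_subset : ∀ k ∈ grid r⁻¹, tsupport (χ k) ⊆ plank d r⁻¹ (node r⁻¹ k)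
  sum_eq_one : ∀ ξ ∈ Metric.cthickening (r⁻¹ ^ 2) cone, ∑ k ∈ grid r⁻¹, χ k ξ = 1

/-- The mollified Fourier projection of `f` with multiplier `m`. -/
noncomputable def fourierPiece (m : E5 → ℝ) (f : 𝓢(E5, ℂ)) : E5 → ℂ :=
  𝓕⁻ fun ξ => (m ξ : ℂ) * 𝓕 (f : E5 → ℂ) ξ

/-- The square function `(∑ |f_θ|²)^{1/2}` over the planks `θ` of scale `r⁻²` contained in the plank
`τ` of scale `s²` over `w`. -/
noncomputable def squareFn (d r s : ℝ) (w : ℂ) (χ : ℤ × ℤ → E5 → ℝ) (f : 𝓢(E5, ℂ)) (x : E5) : ℝ :=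
  √(∑ k ∈ subPlanks d r s w, ‖fourierPiece (χ k) f x‖ ^ 2)

/-- The contribution `∑_U |U|⁻¹ ‖S_U f‖_{L²(U)}⁴` of the plank `τ` of scale `s²` over `w`, where `U`
runs over the translates of the wave envelope of `τ` by the elements of `T`. -/
noncomputable def envelopeSum (d r s : ℝ) (w : ℂ) (T : Set E5) (χ : ℤ × ℤ → E5 → ℝ)
    (f : 𝓢(E5, ℂ)) : ℝ≥0∞ :=
  ∑' x : T, (volume ((x : E5) +ᵥ waveEnvelope d r s w))⁻¹ *
    eLpNorm (squareFn d r s w χ f) 2 (volume.restrict ((x : E5) +ᵥ waveEnvelope d r s w)) ^ 4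

end ComplexCone

open ComplexCone

namespace ComplexCone

section Covering

theorem countable_of_translate_overlap {E : Type*} [NormedAddCommGroup E] [InnerProductSpace ℝ E]
    [FiniteDimensional ℝ E] {U T : Set E} {N : ℕ} (h0 : 0 ∈ interior U)
    (hT : ∀ y, {x ∈ T | y ∈ x +ᵥ U}.encard ≤ N) : T.Countable := by
  obtain ⟨D, hDc, hDd⟩ := TopologicalSpace.exists_countable_dense E
  refine (hDc.biUnion fun q _ => (Set.finite_of_encard_le_coe (hT q)).countable).mono ?_
  intro x hx
  have hopen : IsOpen (x +ᵥ interior U) := isOpen_interior.vadd x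
  obtain ⟨q, hq, hqD⟩ := hDd.inter_open_nonempty (x +ᵥ interior U)
    hopen ⟨x, 0, h0, by simp⟩
  exact Set.mem_biUnion hqD ⟨hx, Set.vadd_set_mono interior_subset hq⟩

variable {E : Type*} [NormedAddCommGroup E] [InnerProductSpace ℝ E] [FiniteDimensional ℝ E]
  [MeasurableSpace E] [BorelSpace E]

theorem ennreal_sq_sum_le {ι : Type*} (s : Finset ι) (f : ι → ℝ≥0∞) :
    (∑ i ∈ s, f i) ^ 2 ≤ s.card * ∑ i ∈ s, f i ^ 2 := by
  have := ENNReal.rpow_sum_le_const_mul_sum_rpow s f (p := 2) (by norm_num)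
  norm_num at this
  exact_mod_cast this

/-- Every point lies in boundedly many of the doubled translates of a cover with bounded overlap. -/
theorem encard_double_translates_le {U T : Set E} {N : ℕ} (hc : Convex ℝ U) (hs : -U = U)
    (hb : Bornology.IsBounded U) (h0 : 0 ∈ interior U)
    (hT : ∀ y, {x ∈ T | y ∈ x +ᵥ U}.encard ≤ N) (y : E) :
    {x ∈ T | y ∈ x +ᵥ (2 : ℝ) • U}.encard ≤ ((3 ^ Module.finrank ℝ E * N : ℕ) : ℕ∞) := by
  by_contra! hlt
  obtain ⟨J, hJ, hJc⟩ := Set.exists_subset_encard_eq (Order.add_one_le_of_lt hlt)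
  have hfin : J.Finite := by
    apply Set.finite_of_encard_eq_coe (k := 3 ^ Module.finrank ℝ E * N + 1)
    rw [hJc]; norm_cast
  obtain ⟨F, rfl⟩ := hfin.exists_finset_coe
  have hFc : F.card = 3 ^ Module.finrank ℝ E * N + 1 := by
    rw [Set.encard_coe_eq_coe_finsetCard] at hJc
    exact_mod_cast hJc
  have hvol0 : volume U ≠ 0 := (isOpen_interior.measure_pos volume ⟨0, h0⟩).ne' ∘ measure_mono_null interior_subset
  have hvolt : volume U ≠ ⊤ := hb.measure_lt_top.ne
  have hmeas : ∀ x : E, NullMeasurableSet (x +ᵥ U) volume := fun x =>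
    (hc.vadd x).nullMeasurableSet _
  have hsub : ∀ x ∈ F, x +ᵥ U ⊆ y +ᵥ (3 : ℝ) • U := by
    intro x hx z hz
    have hyx := (hJ hx).2
    rw [Set.mem_vadd_set] at hz hyx ⊢
    obtain ⟨u, hu, rfl⟩ := hz
    obtain ⟨_, ⟨v, hv, rfl⟩, rfl⟩ := hyx
    have hv' : -v ∈ U := by rw [← hs]; simpa using hv
    refine ⟨u - (2 : ℝ) • v, ?_, by simp only [vadd_eq_add]; abel⟩
    have h3 : (3 : ℝ) • U = (1 : ℝ) • U + (2 : ℝ) • U := by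
      rw [← hc.add_smul (by norm_num) (by norm_num)]; norm_num
    rw [h3, sub_eq_add_neg, ← smul_neg]
    exact Set.add_mem_add ⟨u, hu, one_smul _ _⟩ (Set.smul_mem_smul_set hv')
  have h1 : ∑ x ∈ F, volume (x +ᵥ U) ≤ N * volume (y +ᵥ (3 : ℝ) • U) := by
    calc ∑ x ∈ F, volume (x +ᵥ U)
        = ∑ x ∈ F, ∫⁻ z, (x +ᵥ U).indicator 1 z := by
          refine Finset.sum_congr rfl fun x _ => ?_
          rw [lintegral_indicator_one₀ (hmeas x)]
      _ = ∫⁻ z, ∑ x ∈ F, (x +ᵥ U).indicator 1 z := by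
          rw [lintegral_finsetSum']
          exact fun x _ => (aemeasurable_indicator_const_iff (1 : ℝ≥0∞)).2 (hmeas x)
      _ ≤ ∫⁻ z, (y +ᵥ (3 : ℝ) • U).indicator (fun _ => (N : ℝ≥0∞)) z := by
          refine lintegral_mono fun z => ?_
          by_cases hz : z ∈ y +ᵥ (3 : ℝ) • U
          · rw [Set.indicator_of_mem hz]
            classical
            have : ∑ x ∈ F, (x +ᵥ U).indicator (1 : E → ℝ≥0∞) z
                = ((F.filter fun x => z ∈ x +ᵥ U).card : ℝ≥0∞) := by
              rw [Finset.card_filter]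
              push_cast
              exact Finset.sum_congr rfl fun x _ => by simp [Set.indicator_apply]
            rw [this]
            have h2 : ((F.filter fun x => z ∈ x +ᵥ U : Finset E) : Set E).encard ≤ N := by
              refine (Set.encard_le_encard ?_).trans (hT z)
              intro x hx
              simp only [Finset.coe_filter, Set.mem_ofPred_eq] at hx
              exact ⟨(hJ hx.1).1, hx.2⟩
            rw [Set.encard_coe_eq_coe_finsetCard] at h2
            exact Nat.cast_le.2 (Nat.cast_le.1 h2)
          · rw [Set.indicator_of_notMem hz]
            refine le_of_eq (Finset.sum_eq_zero fun x hx => ?_)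
            exact Set.indicator_of_notMem (fun h => hz (hsub x hx h)) _
      _ ≤ N * volume (y +ᵥ (3 : ℝ) • U) := lintegral_indicator_const_le _ _
  simp only [measure_vadd, Finset.sum_const, hFc, Measure.addHaar_smul, nsmul_eq_mul] at h1
  rw [← mul_assoc, ENNReal.mul_le_mul_iff_left hvol0 hvolt,
    abs_of_nonneg (by positivity), ENNReal.ofReal_pow (by norm_num)] at h1
  norm_num at h1
  have h2 : 3 ^ Module.finrank ℝ E * N + 1 ≤ N * 3 ^ Module.finrank ℝ E := by exact_mod_cast h1
  rw [mul_comm] at h2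
  omega

/-- Local averages over translates of `U` are controlled by a cover by translates of `U`. -/
theorem lintegral_sq_local_lintegral_le {U T : Set E} {N : ℕ} (hc : Convex ℝ U) (hs : -U = U)
    (hb : Bornology.IsBounded U) (h0 : 0 ∈ interior U) (hcov : ∀ y, ∃ x ∈ T, y ∈ x +ᵥ U)
    (hT : ∀ y, {x ∈ T | y ∈ x +ᵥ U}.encard ≤ N) (g : E → ℝ≥0∞) :
    ∫⁻ x : E, (∫⁻ y in x +ᵥ U, g y) ^ 2 ≤
      (3 ^ Module.finrank ℝ E * N : ℕ) * (2 ^ Module.finrank ℝ E * volume U) *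
        ∑' x : T, (∫⁻ y in (x : E) +ᵥ U, g y) ^ 2 := by
  have hTc : Countable T := (countable_of_translate_overlap h0 hT).to_subtype
  have hmeas : ∀ x : E, NullMeasurableSet (x +ᵥ (2 : ℝ) • U) volume := fun x =>
    ((hc.smul 2).vadd x).nullMeasurableSet _
  set K : ℕ := 3 ^ Module.finrank ℝ E * N
  have hpt : ∀ x : E, (∫⁻ y in x +ᵥ U, g y) ^ 2 ≤
      K * ∑' j : T, ((j : E) +ᵥ (2 : ℝ) • U).indicator
        (fun _ => (∫⁻ y in (j : E) +ᵥ U, g y) ^ 2) x := by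
    intro x
    have hcard := encard_double_translates_le hc hs hb h0 hT x
    have hfin : {j : T | x ∈ (j : E) +ᵥ (2 : ℝ) • U}.Finite := by
      have := Set.finite_of_encard_le_coe hcard
      exact Set.Finite.of_finite_image (f := Subtype.val)
        (this.subset (by rintro _ ⟨j, hj, rfl⟩; exact ⟨j.2, hj⟩)) Subtype.val_injective.injOn
    obtain ⟨F, hF⟩ := hfin.exists_finset_coe
    have hFc : F.card ≤ K := by
      have h1 : (F : Set T).encard ≤ K := by
        rw [hF, ← Subtype.val_injective.encard_image]
        refine (Set.encard_le_encard ?_).trans hcard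
        rintro _ ⟨j, hj, rfl⟩
        exact ⟨j.2, hj⟩
      rw [Set.encard_coe_eq_coe_finsetCard] at h1
      exact_mod_cast h1
    have hmemF : ∀ j : T, j ∈ F ↔ x ∈ (j : E) +ᵥ (2 : ℝ) • U := by
      intro j; rw [← Finset.mem_coe, hF]; rfl
    have hsub : x +ᵥ U ⊆ ⋃ j ∈ F, (j : E) +ᵥ U := by
      rintro _ ⟨u, hu, rfl⟩
      obtain ⟨j, hj, v, hv, hv'⟩ := hcov (x +ᵥ u)
      refine Set.mem_biUnion (x := ⟨j, hj⟩) ?_ ⟨v, hv, hv'⟩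
      rw [Finset.mem_coe, hmemF]
      simp only [vadd_eq_add] at hv'
      have hu' : -u ∈ U := by rw [← hs]; simpa using hu
      have h2 : (2 : ℝ) • U = (1 : ℝ) • U + (1 : ℝ) • U := by
        rw [← hc.add_smul (by norm_num) (by norm_num)]; norm_num
      refine ⟨v + -u, ?_, ?_⟩
      · rw [h2, one_smul]; exact Set.add_mem_add hv hu'
      · simp only [vadd_eq_add]; rw [← add_assoc, hv']; abel
    calc (∫⁻ y in x +ᵥ U, g y) ^ 2
        ≤ (∑ j ∈ F, ∫⁻ y in (j : E) +ᵥ U, g y) ^ 2 := by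
          gcongr
          refine (lintegral_mono_set hsub).trans ?_
          have h3 := lintegral_iUnion_le (μ := volume) (fun j : F => ((j : T) : E) +ᵥ U) g
          rw [tsum_fintype, F.sum_coe_sort (fun j : T => ∫⁻ y in (j : E) +ᵥ U, g y)] at h3
          refine le_trans (lintegral_mono_set ?_) h3
          exact Set.iUnion₂_subset fun j hj =>
            Set.subset_iUnion (fun j : F => ((j : T) : E) +ᵥ U) ⟨j, hj⟩
      _ ≤ F.card * ∑ j ∈ F, (∫⁻ y in (j : E) +ᵥ U, g y) ^ 2 := ennreal_sq_sum_le _ _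
      _ = F.card * ∑ j ∈ F, ((j : E) +ᵥ (2 : ℝ) • U).indicator
            (fun _ => (∫⁻ y in (j : E) +ᵥ U, g y) ^ 2) x := by
          congr 1
          refine Finset.sum_congr rfl fun j hj => ?_
          rw [Set.indicator_of_mem ((hmemF j).1 hj)]
      _ ≤ _ := by
          gcongr
          exact ENNReal.sum_le_tsum F
  calc ∫⁻ x : E, (∫⁻ y in x +ᵥ U, g y) ^ 2
      ≤ ∫⁻ x, K * ∑' j : T, ((j : E) +ᵥ (2 : ℝ) • U).indicator
        (fun _ => (∫⁻ y in (j : E) +ᵥ U, g y) ^ 2) x := lintegral_mono hpt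
    _ = K * ∑' j : T, ∫⁻ x, ((j : E) +ᵥ (2 : ℝ) • U).indicator
        (fun _ => (∫⁻ y in (j : E) +ᵥ U, g y) ^ 2) x := by
      rw [lintegral_const_mul' _ _ (by simp), lintegral_tsum]
      exact fun j => aemeasurable_const.indicator₀ (hmeas j)
    _ = K * (2 ^ Module.finrank ℝ E * volume U) *
        ∑' x : T, (∫⁻ y in (x : E) +ᵥ U, g y) ^ 2 := by
      rw [mul_assoc]
      congr 1
      rw [← ENNReal.tsum_mul_left]
      congr 1
      funext j
      rw [lintegral_indicator_const₀ (hmeas j), measure_vadd, Measure.addHaar_smul,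
        abs_of_nonneg (by positivity), ENNReal.ofReal_pow (by norm_num), mul_comm]
      norm_num

end Covering

section LocalPlancherel

theorem exists_schwartz_bump {E : Type*} [NormedAddCommGroup E] [InnerProductSpace ℝ E]
    [FiniteDimensional ℝ E] {W : Set E} (hc : Convex ℝ W) (hb : Bornology.IsBounded W)
    (h0 : 0 ∈ interior W) :
    ∃ (ψ : 𝓢(E, ℂ)) (φ : E → ℝ), (∀ x, ψ x = φ x) ∧ (∀ x, 0 ≤ φ x) ∧ (∀ x, φ x ≤ 1) ∧
      (∀ x ∉ W, φ x = 0) ∧ ∀ x ∈ (2⁻¹ : ℝ) • W, φ x = 1 := by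
  have hsub : closure ((2⁻¹ : ℝ) • W) ⊆ interior W := by
    rw [closure_smul₀]
    rintro _ ⟨y, hy, rfl⟩
    have := hc.combo_interior_closure_mem_interior h0 hy (a := 2⁻¹) (b := 2⁻¹)
      (by norm_num) (by norm_num) (by norm_num)
    simpa using this
  obtain ⟨φ, hφ, hr, hsupp, h1⟩ := exists_contMDiff_support_eq_eq_one_iff (n := ⊤)
    (modelWithCornersSelf ℝ E) isOpen_interior isClosed_closure hsub
  have hcs : HasCompactSupport φ :=
    HasCompactSupport.of_support_subset_isCompact hb.isCompact_closure
      (hsupp.le.trans (interior_subset.trans subset_closure))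
  have hcs' : HasCompactSupport fun x => (φ x : ℂ) := hcs.comp_left Complex.ofReal_zero
  have hsm : ContDiff ℝ ∞ fun x => (φ x : ℂ) :=
    Complex.ofRealCLM.contDiff.comp hφ.contDiff
  refine ⟨hcs'.toSchwartzMap hsm, φ, fun _ => rfl, fun x => (hr ⟨x, rfl⟩).1,
    fun x => (hr ⟨x, rfl⟩).2, fun x hx => ?_, fun x hx => (h1 x).1 (subset_closure hx)⟩
  by_contra h
  exact hx (interior_subset (hsupp.le h))

variable {E : Type*} [NormedAddCommGroup E] [InnerProductSpace ℝ E] [FiniteDimensional ℝ E]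
  [MeasurableSpace E] [BorelSpace E]

/-- The Fourier transform of a bump function adapted to `W` is large where the characters vary
little on `W`. -/
theorem norm_fourier_bump_ge {W : Set E} (hc : Convex ℝ W)
    {ψ : 𝓢(E, ℂ)} {φ : E → ℝ} (hψ : ∀ x, ψ x = φ x) (hφ0 : ∀ x, 0 ≤ φ x)
    (hφW : ∀ x ∉ W, φ x = 0) (hφ1 : ∀ x ∈ (2⁻¹ : ℝ) • W, φ x = 1) {ξ : E}
    (hξ : ∀ x ∈ W, |inner ℝ x ξ| ≤ 1 / 6) :
    (2⁻¹ : ℝ) ^ Module.finrank ℝ E * volume.real W / 2 ≤ ‖𝓕 ψ ξ‖ := by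
  have hint : Integrable (fun x => Real.fourierChar (-inner ℝ x ξ) • ψ x) := by
    simpa using (Real.fourierIntegral_convergent_iff ξ).2 ψ.integrable
  have hφint : Integrable φ := by
    have := ψ.integrable (μ := volume) |>.re
    refine this.congr (Filter.Eventually.of_forall fun x => ?_)
    simp [hψ]
  have hpt : ∀ x, φ x / 2 ≤ (Real.fourierChar (-inner ℝ x ξ) • ψ x).re := by
    intro x
    by_cases hx : x ∈ W
    · have h1 : (Real.fourierChar (-inner ℝ x ξ) • ψ x).re
          = Real.cos (2 * Real.pi * inner ℝ x ξ) * φ x := by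
        rw [Circle.smul_def, Real.fourierChar_apply, hψ, smul_eq_mul, Complex.re_mul_ofReal,
          Complex.exp_ofReal_mul_I_re, mul_neg, Real.cos_neg]
      rw [h1]
      have h2 : (1 : ℝ) / 2 ≤ Real.cos (2 * Real.pi * inner ℝ x ξ) := by
        rw [← Real.cos_abs, ← Real.cos_pi_div_three]
        have h3 : |2 * Real.pi * inner ℝ x ξ| ≤ Real.pi / 3 := by
          rw [abs_mul, abs_of_pos Real.two_pi_pos]
          nlinarith [hξ x hx, Real.pi_pos]
        exact Real.cos_le_cos_of_nonneg_of_le_pi (abs_nonneg _)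
          (by linarith [Real.pi_pos]) h3
      nlinarith [hφ0 x]
    · simp [hφW x hx, hψ]
  calc (2⁻¹ : ℝ) ^ Module.finrank ℝ E * volume.real W / 2
      = (∫ x, ((2⁻¹ : ℝ) • W).indicator 1 x) / 2 := by
        rw [integral_indicator₀ ((hc.smul _).nullMeasurableSet _)]
        simp only [Pi.one_apply, setIntegral_const, smul_eq_mul, mul_one]
        rw [measureReal_def, measureReal_def, Measure.addHaar_smul, ENNReal.toReal_mul,
          ENNReal.toReal_ofReal (abs_nonneg _), abs_of_nonneg (by positivity)]
    _ ≤ (∫ x, φ x) / 2 := by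
        refine div_le_div_of_nonneg_right ?_ zero_le_two
        refine integral_mono_of_nonneg (Filter.Eventually.of_forall fun x =>
          Set.indicator_nonneg (fun _ _ => zero_le_one) x) hφint
          (Filter.Eventually.of_forall fun x => ?_)
        by_cases hx : x ∈ (2⁻¹ : ℝ) • W
        · simp [hx, hφ1 x hx]
        · simp [hx, hφ0 x]
    _ = ∫ x, φ x / 2 := (integral_div _ _).symm
    _ ≤ ∫ x, (Real.fourierChar (-inner ℝ x ξ) • ψ x).re := by
        exact integral_mono (hφint.div_const 2) hint.re hpt
    _ = (𝓕 ψ ξ).re := by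
        rw [SchwartzMap.fourier_coe, Real.fourier_eq]
        exact integral_re hint
    _ ≤ ‖𝓕 ψ ξ‖ := Complex.re_le_norm _

theorem lintegral_enorm_sq_fourier (P : 𝓢(E, ℂ)) :
    ∫⁻ ζ, ‖𝓕 P ζ‖ₑ ^ 2 = ∫⁻ x, ‖P x‖ₑ ^ 2 := by
  have key : ∀ Q : 𝓢(E, ℂ), ∫⁻ x, ‖Q x‖ₑ ^ 2 = ENNReal.ofReal (∫ x, ‖Q x‖ ^ 2) := by
    intro Q
    have hi : Integrable fun x => ‖Q x‖ ^ 2 := (Q.memLp 2).integrable_norm_pow (by norm_num)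
    rw [ofReal_integral_eq_lintegral_ofReal hi (Filter.Eventually.of_forall fun x => by positivity)]
    refine lintegral_congr fun x => ?_
    rw [ENNReal.ofReal_pow (norm_nonneg _), ofReal_norm]
  rw [key, key, SchwartzMap.integral_norm_sq_fourier]

/-- If characters with frequency in `V` vary little on a symmetric convex body `W`, the part of the
`L²` mass of `P` with frequency in `V` is controlled by averages of `P` over translates of `W`. -/
theorem lintegral_fourier_sq_le_of_inner_le {W V : Set E} (hc : Convex ℝ W) (hs : -W = W)
    (hb : Bornology.IsBounded W) (h0 : 0 ∈ interior W)
    (hV : MeasurableSet V) (hξ : ∀ ξ ∈ V, ∀ x ∈ W, |inner ℝ x ξ| ≤ 1 / 6) (P : 𝓢(E, ℂ)) :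
    (2⁻¹ ^ (Module.finrank ℝ E + 1) * volume W) ^ 2 * ∫⁻ ξ in V, ‖𝓕 P ξ‖ₑ ^ 2 ≤
      ∫⁻ x : E, (∫⁻ y in x +ᵥ W, ‖P y‖ₑ) ^ 2 := by
  obtain ⟨ψ, φ, hψ, hφ0, hφ1, hφW, hφ⟩ := exists_schwartz_bump hc hb h0
  set H : 𝓢(E, ℂ) := SchwartzMap.convolution (ContinuousLinearMap.mul ℂ ℂ) ψ P
  have hF : ∀ ξ, 𝓕 H ξ = 𝓕 ψ ξ * 𝓕 P ξ := by
    intro ξ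
    simp [H, SchwartzMap.fourier_convolution]
  have hψV : ∀ ξ ∈ V, 2⁻¹ ^ (Module.finrank ℝ E + 1) * volume W ≤ ‖𝓕 ψ ξ‖ₑ := by
    intro ξ hξV
    have h1 := norm_fourier_bump_ge hc hψ hφ0 hφW hφ (hξ ξ hξV)
    have h2 : (2⁻¹ : ℝ≥0∞) ^ (Module.finrank ℝ E + 1) * volume W
        = ENNReal.ofReal ((2⁻¹ : ℝ) ^ Module.finrank ℝ E * volume.real W / 2) := by
      rw [div_eq_mul_inv, mul_right_comm, ← pow_succ, ENNReal.ofReal_mul (by positivity),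
        ENNReal.ofReal_pow (by norm_num), ENNReal.ofReal_inv_of_pos (by norm_num),
        ofReal_measureReal hb.measure_lt_top.ne]
      norm_num
    rw [h2, ← ofReal_norm]
    exact ENNReal.ofReal_le_ofReal h1
  have hH : ∀ x, ‖H x‖ₑ ≤ ∫⁻ y in x +ᵥ W, ‖P y‖ₑ := by
    intro x
    rw [show H x = _ from SchwartzMap.convolution_apply _ ψ P x]
    calc ‖∫ t, ContinuousLinearMap.mul ℂ ℂ (ψ t) (P (x - t))‖ₑ
        ≤ ∫⁻ t, ‖ContinuousLinearMap.mul ℂ ℂ (ψ t) (P (x - t))‖ₑ :=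
          enorm_integral_le_lintegral_enorm _
      _ ≤ ∫⁻ t, (x +ᵥ W).indicator (fun y => ‖P y‖ₑ) (x - t) := by
          refine lintegral_mono fun t => ?_
          by_cases ht : t ∈ W
          · have ht' : -t ∈ W := by rw [← hs]; simpa using ht
            have hmem : x - t ∈ x +ᵥ W := ⟨-t, ht', by simp [sub_eq_add_neg]⟩
            rw [Set.indicator_of_mem hmem]
            simp only [ContinuousLinearMap.mul_apply', enorm_mul]
            refine mul_le_of_le_one_left' ?_
            rw [hψ, ← ofReal_norm, Complex.norm_real, Real.norm_of_nonneg (hφ0 t)]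
            exact ENNReal.ofReal_le_one.2 (hφ1 t)
          · simp [hψ, hφW t ht]
      _ = ∫⁻ y, (x +ᵥ W).indicator (fun y => ‖P y‖ₑ) y :=
          lintegral_sub_left_eq_self (fun y => (x +ᵥ W).indicator (fun y => ‖P y‖ₑ) y) x
      _ = ∫⁻ y in x +ᵥ W, ‖P y‖ₑ :=
          lintegral_indicator₀ ((hc.vadd x).nullMeasurableSet _) _
  have hfin : (2⁻¹ ^ (Module.finrank ℝ E + 1) * volume W) ^ 2 ≠ (⊤ : ℝ≥0∞) :=
    ENNReal.pow_ne_top (ENNReal.mul_ne_top (by simp) hb.measure_lt_top.ne)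
  rw [← lintegral_const_mul' _ _ hfin]
  calc ∫⁻ ξ in V, (2⁻¹ ^ (Module.finrank ℝ E + 1) * volume W) ^ 2 * ‖𝓕 P ξ‖ₑ ^ 2
      ≤ ∫⁻ ξ in V, ‖𝓕 H ξ‖ₑ ^ 2 := by
        refine setLIntegral_mono' hV fun ξ hξV => ?_
        rw [hF, enorm_mul, mul_pow ‖𝓕 ψ ξ‖ₑ]
        exact mul_le_mul' (pow_le_pow_left' (hψV ξ hξV) 2) le_rfl
    _ ≤ ∫⁻ ξ, ‖𝓕 H ξ‖ₑ ^ 2 := setLIntegral_le_lintegral _ _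
    _ = ∫⁻ x, ‖H x‖ₑ ^ 2 := lintegral_enorm_sq_fourier H
    _ ≤ _ := lintegral_mono fun x => by gcongr; exact hH x

/-- The part of the `L²` mass of `P` at frequencies dual to `U` is controlled by the `L¹` masses of
`P` on a cover by translates of `U`. -/
theorem lintegral_fourier_sq_le_tsum {U V T : Set E} {N : ℕ} (hc : Convex ℝ U) (hs : -U = U)
    (hb : Bornology.IsBounded U) (h0 : 0 ∈ interior U) (hcov : ∀ y, ∃ x ∈ T, y ∈ x +ᵥ U)
    (hT : ∀ y, {x ∈ T | y ∈ x +ᵥ U}.encard ≤ N) (hV : MeasurableSet V) {K : ℝ} (hK : 1 ≤ K)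
    (hξ : ∀ ξ ∈ V, ∀ x ∈ U, |inner ℝ x ξ| ≤ K) (P : 𝓢(E, ℂ)) :
    ∫⁻ ξ in V, ‖𝓕 P ξ‖ₑ ^ 2 ≤
      ((6 ^ Module.finrank ℝ E * N : ℕ) * (4 * (12 * ENNReal.ofReal K) ^ (2 * Module.finrank ℝ E)))
        * ∑' x : T, (volume ((x : E) +ᵥ U))⁻¹ * (∫⁻ y in (x : E) +ᵥ U, ‖P y‖ₑ) ^ 2 := by
  set n := Module.finrank ℝ E
  have hK0 : 0 < K := by linarith
  have h0U : (0 : E) ∈ U := interior_subset h0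
  set ε : ℝ := (6 * K)⁻¹ with hε
  have hε0 : 0 < ε := by positivity
  have hε1 : ε ≤ 1 := inv_le_one_of_one_le₀ (by linarith)
  have hWU : ε • U ⊆ U := by
    rintro _ ⟨u, hu, rfl⟩
    exact hc.smul_mem_of_zero_mem h0U hu ⟨hε0.le, hε1⟩
  have h0W : (0 : E) ∈ interior (ε • U) := by
    rw [interior_smul₀ hε0.ne']
    exact ⟨0, h0, smul_zero _⟩
  have h1 := lintegral_fourier_sq_le_of_inner_le (hc.smul ε) (by rw [← Set.smul_set_neg, hs])
    (hb.smul₀ ε) h0W hV (fun ξ hξV x hx => by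
      obtain ⟨u, hu, rfl⟩ := hx
      rw [real_inner_smul_left, abs_mul, abs_of_pos hε0]
      calc ε * |inner ℝ u ξ| ≤ ε * K := by gcongr; exact hξ ξ hξV u hu
        _ = 1 / 6 := by rw [hε]; field_simp) P
  have h2 := h1.trans (lintegral_mono fun x =>
    pow_le_pow_left' (lintegral_mono_set (Set.vadd_set_mono hWU)) 2)
  have h3 := h2.trans (lintegral_sq_local_lintegral_le hc hs hb h0 hcov hT fun y => ‖P y‖ₑ)
  have hvol0 : volume U ≠ 0 :=
    (isOpen_interior.measure_pos volume ⟨0, h0⟩).ne' ∘ measure_mono_null interior_subset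
  have hvolt : volume U ≠ ⊤ := hb.measure_lt_top.ne
  set v := volume U
  set I := ∫⁻ ξ in V, ‖𝓕 P ξ‖ₑ ^ 2
  set S := ∑' x : T, (∫⁻ y in (x : E) +ᵥ U, ‖P y‖ₑ) ^ 2
  set k : ℝ≥0∞ := ENNReal.ofReal K with hk
  have hk0 : k ≠ 0 := by simpa [hk] using hK0
  have hkt : k ≠ ⊤ := ENNReal.ofReal_ne_top
  have hW : volume (ε • U) = (6 * k)⁻¹ ^ n * v := by
    rw [Measure.addHaar_smul, abs_of_nonneg (by positivity), ENNReal.ofReal_pow hε0.le, hε,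
      ENNReal.ofReal_inv_of_pos (by positivity), ENNReal.ofReal_mul (by norm_num)]
    norm_num
    rfl
  rw [hW] at h3
  have hone : 4 * (12 * k) ^ (2 * n) * (2⁻¹ ^ (n + 1) * (6 * k)⁻¹ ^ n) ^ 2 = 1 := by
    have h4 : (12 * k) ^ n * (2⁻¹ ^ n * (6 * k)⁻¹ ^ n) = 1 := by
      rw [← mul_pow, ← mul_pow, ← ENNReal.mul_inv (by simp) (by simp),
        show 2 * (6 * k) = 12 * k by ring, ENNReal.mul_inv_cancel (by simp [hk0])
        (ENNReal.mul_ne_top (by simp) hkt), one_pow]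
    have h5 : (2 : ℝ≥0∞) * 2⁻¹ = 1 := ENNReal.mul_inv_cancel (by simp) (by simp)
    calc _ = (2 * 2⁻¹) ^ 2 * ((12 * k) ^ n * (2⁻¹ ^ n * (6 * k)⁻¹ ^ n)) ^ 2 := by ring
      _ = 1 := by rw [h4, h5]; norm_num
  have hvv : v⁻¹ * v = 1 := ENNReal.inv_mul_cancel hvol0 hvolt
  calc I = (4 * (12 * k) ^ (2 * n) * (2⁻¹ ^ (n + 1) * (6 * k)⁻¹ ^ n) ^ 2) * (v⁻¹ * v) ^ 2 * I := by
        rw [hone, hvv]; simp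
    _ = 4 * (12 * k) ^ (2 * n) * v⁻¹ ^ 2 *
          ((2⁻¹ ^ (n + 1) * ((6 * k)⁻¹ ^ n * v)) ^ 2 * I) := by ring
    _ ≤ 4 * (12 * k) ^ (2 * n) * v⁻¹ ^ 2 * ((3 ^ n * N : ℕ) * (2 ^ n * v) * S) := by gcongr
    _ = (3 ^ n * 2 ^ n * N) * (4 * (12 * k) ^ (2 * n)) * ((v⁻¹ * v) * (v⁻¹ * S)) := by
        push_cast; ring
    _ = _ := by
        rw [hvv, one_mul, ← ENNReal.tsum_mul_left, ← mul_pow]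
        simp only [measure_vadd]
        push_cast
        norm_num
        rfl

end LocalPlancherel

/-- The first complex coordinate of a point of `ℂ × ℂ × ℝ`. -/
def fstC (ξ : E5) : ℂ := ⟨ξ 0, ξ 1⟩

/-- The second complex coordinate of a point of `ℂ × ℂ × ℝ`. -/
def sndC (ξ : E5) : ℂ := ⟨ξ 2, ξ 3⟩

/-- The quadratic polynomial `v - 2 u z + h z²` attached to the frequency `(u, v, h)`. -/
def normalPoly (ξ : E5) (z : ℂ) : ℂ := sndC ξ - 2 * z * fstC ξ + ξ 4 * z ^ 2

/-- Half the derivative of `normalPoly`. -/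
def tangentPoly (ξ : E5) (z : ℂ) : ℂ := ξ 4 * z - fstC ξ

/-- The quarter discriminant of `normalPoly`. -/
def discr (ξ : E5) : ℂ := fstC ξ ^ 2 - ξ 4 * sndC ξ

theorem tangentPoly_sq (ξ : E5) (z : ℂ) :
    tangentPoly ξ z ^ 2 = discr ξ + ξ 4 * normalPoly ξ z := by
  simp only [tangentPoly, discr, normalPoly]; ring

theorem tangentPoly_sub (ξ : E5) (z w : ℂ) :
    tangentPoly ξ z - tangentPoly ξ w = ξ 4 * (z - w) := by
  simp only [tangentPoly]; ring

theorem normalPoly_sub (ξ : E5) (z w : ℂ) :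
    normalPoly ξ z - normalPoly ξ w = (z - w) * (tangentPoly ξ z + tangentPoly ξ w) := by
  simp only [tangentPoly, normalPoly]; ring

theorem fstC_sub (ξ η : E5) : fstC (ξ - η) = fstC ξ - fstC η := by
  apply Complex.ext <;> simp [fstC]

theorem sndC_sub (ξ η : E5) : sndC (ξ - η) = sndC ξ - sndC η := by
  apply Complex.ext <;> simp [sndC]

theorem tangentPoly_sub_left (ξ η : E5) (z : ℂ) :
    tangentPoly (ξ - η) z = tangentPoly ξ z - tangentPoly η z := by
  simp only [tangentPoly, fstC_sub, PiLp.sub_apply, Complex.ofReal_sub]; ring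

theorem normalPoly_sub_left (ξ η : E5) (z : ℂ) :
    normalPoly (ξ - η) z = normalPoly ξ z - normalPoly η z := by
  simp only [normalPoly, fstC_sub, sndC_sub, PiLp.sub_apply, Complex.ofReal_sub]; ring

theorem eq_combination_iff (ξ : E5) (z : ℂ) (a b₁ b₂ c₁ c₂ e : ℝ) :
    ξ = a • cVec z + b₁ • tVecS z + b₂ • tVecT z + c₁ • nVecS z + c₂ • nVecT z + e • nVec5 ↔
      ξ 4 = a + e ∧ fstC ξ = a * z + ⟨b₁, b₂⟩ - 2 * star z * ⟨c₁, c₂⟩ ∧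
        sndC ξ = a * z ^ 2 + 2 * z * ⟨b₁, b₂⟩ + ⟨c₁, c₂⟩ := by
  constructor
  · rintro rfl
    refine ⟨?_, ?_, ?_⟩
    · simp [cVec, tVecS, tVecT, nVecS, nVecT, nVec5]
    · apply Complex.ext <;> simp [fstC, cVec, tVecS, tVecT, nVecS, nVecT, nVec5] <;> ring
    · apply Complex.ext <;> simp [sndC, cVec, tVecS, tVecT, nVecS, nVecT, nVec5, pow_two] <;> ring
  · rintro ⟨h4, hf, hs⟩
    rw [Complex.ext_iff] at hf hs
    simp [fstC, sndC, pow_two] at hf hs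
    ext i
    fin_cases i <;> simp [cVec, tVecS, tVecT, nVecS, nVecT, nVec5]
    · linarith [hf.1]
    · linarith [hf.2]
    · linarith [hs.1]
    · linarith [hs.2]
    · exact h4

theorem mem_plank_iff {d ρ : ℝ} {z : ℂ} {ξ : E5} :
    ξ ∈ plank d ρ z ↔ ∃ (a e : ℝ) (b c : ℂ), 1 / 2 ≤ a ∧ a ≤ 1 ∧ |b.re| ≤ d * ρ ∧ |b.im| ≤ d * ρ ∧
      |c.re| ≤ d * ρ ^ 2 ∧ |c.im| ≤ d * ρ ^ 2 ∧ |e| ≤ d * ρ ^ 2 ∧ ξ 4 = a + e ∧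
      fstC ξ = a * z + b - 2 * star z * c ∧ sndC ξ = a * z ^ 2 + 2 * z * b + c := by
  constructor
  · rintro ⟨a, b₁, b₂, c₁, c₂, e, h1, h2, h3, h4, h5, h6, h7, h⟩
    exact ⟨a, e, ⟨b₁, b₂⟩, ⟨c₁, c₂⟩, h1, h2, h3, h4, h5, h6, h7,
      (eq_combination_iff ξ z a b₁ b₂ c₁ c₂ e).1 h⟩
  · rintro ⟨a, e, b, c, h1, h2, h3, h4, h5, h6, h7, h⟩
    exact ⟨a, b.re, b.im, c.re, c.im, e, h1, h2, h3, h4, h5, h6, h7,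
      (eq_combination_iff ξ z a b.re b.im c.re c.im e).2 h⟩

theorem norm_le_three_halves {x : ℂ} {t : ℝ} (h1 : |x.re| ≤ t) (h2 : |x.im| ≤ t) :
    ‖x‖ ≤ 3 / 2 * t := by
  have ht : 0 ≤ t := (abs_nonneg _).trans h1
  refine (sq_le_sq₀ (norm_nonneg _) (by positivity)).1 ?_
  rw [Complex.sq_norm, Complex.normSq_apply]
  have := sq_le_sq' (abs_le.1 h1).1 (abs_le.1 h1).2
  have := sq_le_sq' (abs_le.1 h2).1 (abs_le.1 h2).2
  nlinarith

theorem one_add_four_mul_star (z : ℂ) :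
    (1 + 4 * z * star z : ℂ) = ((1 + 4 * ‖z‖ ^ 2 : ℝ) : ℂ) := by
  rw [mul_assoc, Complex.star_def, Complex.mul_conj, Complex.normSq_eq_norm_sq]; push_cast; ring

theorem norm_one_add_four_mul_star (z : ℂ) : ‖(1 + 4 * z * star z : ℂ)‖ = 1 + 4 * ‖z‖ ^ 2 := by
  rw [one_add_four_mul_star, Complex.norm_real, Real.norm_of_nonneg (by positivity)]

theorem norm_div_one_add_le (x z : ℂ) : ‖x / (1 + 4 * z * star z)‖ ≤ ‖x‖ := by
  rw [norm_div, norm_one_add_four_mul_star]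
  exact div_le_self (norm_nonneg _) (by nlinarith [norm_nonneg z])

theorem norm_mul_div_one_add_le (x z : ℂ) : ‖4 * x * z / (1 + 4 * z * star z)‖ ≤ ‖x‖ := by
  rw [norm_div, norm_one_add_four_mul_star, div_le_iff₀ (by positivity)]
  simp only [norm_mul, Complex.norm_ofNat]
  nlinarith [sq_nonneg (2 * ‖z‖ - 1), norm_nonneg x]

theorem norm_mul_star_div_one_add_le (x z : ℂ) :
    ‖2 * x * star z / (1 + 4 * z * star z)‖ ≤ ‖x‖ / 2 := by
  rw [norm_div, norm_one_add_four_mul_star, div_le_iff₀ (by positivity)]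
  simp only [norm_mul, Complex.norm_ofNat, norm_star]
  nlinarith [sq_nonneg (2 * ‖z‖ - 1), norm_nonneg x]

theorem one_add_ne_zero (z : ℂ) : (1 + 4 * z * star z : ℂ) ≠ 0 := by
  rw [← norm_ne_zero_iff, norm_one_add_four_mul_star]; positivity

theorem plank_bounds {d ρ : ℝ} {z : ℂ} (hd : 1 ≤ d) (hρ : 0 < ρ) (hρ1 : ρ ≤ 1) (hz : ‖z‖ ≤ 3)
    {ξ : E5} (hξ : ξ ∈ plank d ρ z) :
    |ξ 4| ≤ 2 * d ∧ ‖tangentPoly ξ z‖ ≤ 15 * d * ρ ∧ ‖normalPoly ξ z‖ ≤ 65 * d * ρ ^ 2 := by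
  obtain ⟨a, e, b, c, h1, h2, h3, h4, h5, h6, h7, h8, h9, h10⟩ := mem_plank_iff.1 hξ
  have hb := norm_le_three_halves h3 h4
  have hc := norm_le_three_halves h5 h6
  have hρ2 : ρ ^ 2 ≤ ρ := by nlinarith
  have hdρ : d * ρ ^ 2 ≤ d * ρ := by gcongr
  have he : ‖(e : ℂ)‖ ≤ d * ρ ^ 2 := by rwa [Complex.norm_real]
  have hez : ‖(e : ℂ) * z‖ ≤ d * ρ ^ 2 * 3 := by
    rw [norm_mul]; exact mul_le_mul he hz (norm_nonneg _) (by positivity)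
  have hezz : ‖(e : ℂ) * z ^ 2‖ ≤ d * ρ ^ 2 * 3 ^ 2 := by
    rw [norm_mul, norm_pow]; gcongr
  have hzc : ‖2 * star z * c‖ ≤ 2 * 3 * (3 / 2 * (d * ρ ^ 2)) := by
    simp only [norm_mul, Complex.norm_ofNat, norm_star]; gcongr
  have hcz : ‖c * (1 + 4 * z * star z)‖ ≤ 3 / 2 * (d * ρ ^ 2) * (1 + 4 * 3 ^ 2) := by
    rw [norm_mul, norm_one_add_four_mul_star]; gcongr
  refine ⟨?_, ?_, ?_⟩
  · rw [h8, abs_le]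
    rw [abs_le] at h7
    constructor <;> nlinarith
  · have : tangentPoly ξ z = e * z - b + 2 * star z * c := by
      rw [tangentPoly, h8, h9]; push_cast; ring
    rw [this]
    refine (norm_add_le _ _).trans ((add_le_add_left (norm_sub_le _ _) _).trans ?_)
    nlinarith
  · have : normalPoly ξ z = c * (1 + 4 * z * star z) + e * z ^ 2 := by
      rw [normalPoly, h8, h9, h10]; push_cast; ring
    rw [this]
    refine (norm_add_le _ _).trans ?_
    nlinarith

theorem plank_sub_bounds {d ρ : ℝ} {z : ℂ} (hd : 1 ≤ d) (hρ : 0 < ρ) (hρ1 : ρ ≤ 1) (hz : ‖z‖ ≤ 3)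
    {ξ η : E5} (hξ : ξ ∈ plank d ρ z) (hη : η ∈ plank d ρ z) :
    |(ξ - η) 4| ≤ 130 * d ∧ ‖tangentPoly (ξ - η) z‖ ≤ 130 * d * ρ ∧
      ‖normalPoly (ξ - η) z‖ ≤ 130 * d * ρ ^ 2 := by
  obtain ⟨h1, h2, h3⟩ := plank_bounds hd hρ hρ1 hz hξ
  obtain ⟨k1, k2, k3⟩ := plank_bounds hd hρ hρ1 hz hη
  have hdρ : 0 < d * ρ := by positivity
  refine ⟨?_, ?_, ?_⟩
  · rw [PiLp.sub_apply]
    have := abs_sub (ξ 4) (η 4)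
    linarith
  · rw [tangentPoly_sub_left]
    have := norm_sub_le (tangentPoly ξ z) (tangentPoly η z)
    linarith
  · rw [normalPoly_sub_left]
    have := norm_sub_le (normalPoly ξ z) (normalPoly η z)
    linarith

theorem change_of_base_fst {L w w' x x' a b c y : ℂ} (hL : L = 1 + 4 * w * w') (h0 : L ≠ 0) :
    a * (w + x) + b - 2 * (w' + x') * c =
      a * w + (a * x + b + (2 * y * w' / L - 2 * (c * x') / L)) -
        2 * w' * (c + (y / L + 4 * (c * x') * w / L)) := by
  have : 2 * y * w' / L - 2 * (c * x') / L - 2 * w' * (y / L + 4 * (c * x') * w / L)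
      = -2 * (c * x') := by
    field_simp
    rw [hL]; ring
  linear_combination -this

theorem change_of_base_snd {L w w' x x' a b c : ℂ} (hL : L = 1 + 4 * w * w') (h0 : L ≠ 0) :
    a * (w + x) ^ 2 + 2 * (w + x) * b + c =
      a * w ^ 2 + 2 * w * (a * x + b + (2 * (a * x ^ 2 + 2 * b * x) * w' / L - 2 * (c * x') / L)) +
        (c + ((a * x ^ 2 + 2 * b * x) / L + 4 * (c * x') * w / L)) := by
  have : 2 * w * (2 * (a * x ^ 2 + 2 * b * x) * w' / L - 2 * (c * x') / L) +
      ((a * x ^ 2 + 2 * b * x) / L + 4 * (c * x') * w / L) = a * x ^ 2 + 2 * b * x := by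
    field_simp
    rw [hL]; ring
  linear_combination -this

theorem norm_change_of_base_le {d ρ s : ℝ} {w x a b c : ℂ} (hd : 0 ≤ d) (hρ : 0 ≤ ρ)
    (hρ1 : ρ ≤ 1) (hs : 0 ≤ s) (hs1 : s ≤ 1) (ha : ‖a‖ ≤ 1) (hb : ‖b‖ ≤ 3 / 2 * (d * ρ))
    (hc : ‖c‖ ≤ 3 / 2 * (d * ρ ^ 2)) (hx : ‖x‖ ≤ 3 / 2 * s) (hx2 : ‖x‖ ^ 2 ≤ 2 * s ^ 2) :
    ‖2 * (a * x ^ 2 + 2 * b * x) * star w / (1 + 4 * w * star w) -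
        2 * (c * star x) / (1 + 4 * w * star w)‖ ≤ s + 27 / 4 * (d * ρ) ∧
      ‖(a * x ^ 2 + 2 * b * x) / (1 + 4 * w * star w) +
        4 * (c * star x) * w / (1 + 4 * w * star w)‖ ≤
          2 * s ^ 2 + 9 / 2 * (d * ρ * s) + 9 / 4 * (d * ρ ^ 2) := by
  set y : ℂ := a * x ^ 2 + 2 * b * x with hy
  set u : ℂ := c * star x with hu
  have hdρ : 0 ≤ d * ρ := by positivity
  have hdρ2 : 0 ≤ d * ρ ^ 2 := by positivity
  have hynorm : ‖y‖ ≤ 2 * s ^ 2 + 9 / 2 * (d * ρ * s) := by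
    refine (norm_add_le _ _).trans ?_
    simp only [norm_mul, norm_pow, Complex.norm_ofNat]
    have e1 : ‖a‖ * ‖x‖ ^ 2 ≤ 1 * (2 * s ^ 2) := by gcongr
    have e2 : 2 * ‖b‖ * ‖x‖ ≤ 2 * (3 / 2 * (d * ρ)) * (3 / 2 * s) := by gcongr
    linarith
  have hunorm : ‖u‖ ≤ 9 / 4 * (d * ρ ^ 2 * s) := by
    rw [hu, norm_mul, norm_star]
    have : ‖c‖ * ‖x‖ ≤ (3 / 2 * (d * ρ ^ 2)) * (3 / 2 * s) := by gcongr
    linarith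
  have e3 : d * ρ * s ≤ d * ρ := mul_le_of_le_one_right hdρ hs1
  have e4 : d * ρ ^ 2 * s ≤ d * ρ ^ 2 := mul_le_of_le_one_right hdρ2 hs1
  have e5 : d * ρ ^ 2 ≤ d * ρ := by
    rw [pow_two, ← mul_assoc]; exact mul_le_of_le_one_right hdρ hρ1
  have e6 : s ^ 2 ≤ s := by rw [pow_two]; exact mul_le_of_le_one_right hs hs1
  have f1 := norm_mul_star_div_one_add_le y w
  have f2 := norm_div_one_add_le (2 * u) w
  have f3 := norm_div_one_add_le y w
  have f4 := norm_mul_div_one_add_le u w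
  rw [norm_mul, Complex.norm_ofNat] at f2
  constructor
  · refine (norm_sub_le _ _).trans ?_
    linarith
  · refine (norm_add_le _ _).trans ?_
    linarith

/-- Planks of a much smaller scale with nearby base point are contained in a given plank. -/
theorem plank_subset_plank {d ρ s : ℝ} {z w : ℂ} (hd : 3 ≤ d) (hρ : 0 < ρ) (hρs : 32 * ρ ≤ s)
    (hs : s ≤ 1) (hre : |(z - w).re| ≤ s) (him : |(z - w).im| ≤ s) :
    plank d ρ z ⊆ plank d s w := by
  intro ξ hξ
  obtain ⟨a, e, b, c, h1, h2, h3, h4, h5, h6, h7, h8, h9, h10⟩ := mem_plank_iff.1 hξ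
  obtain ⟨x, rfl⟩ : ∃ x, z = w + x := ⟨z - w, by ring⟩
  rw [add_sub_cancel_left] at hre him
  have hs0 : 0 < s := by linarith
  have hx2 : ‖x‖ ^ 2 ≤ 2 * s ^ 2 := by
    rw [Complex.sq_norm, Complex.normSq_apply]
    have := sq_le_sq' (abs_le.1 hre).1 (abs_le.1 hre).2
    have := sq_le_sq' (abs_le.1 him).1 (abs_le.1 him).2
    linarith
  have ha : ‖(a : ℂ)‖ ≤ 1 := by
    rw [Complex.norm_real, Real.norm_eq_abs, abs_le]; constructor <;> linarith
  obtain ⟨hb', hc'⟩ := norm_change_of_base_le (w := w) (by linarith : 0 ≤ d) hρ.le (by linarith)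
    hs0.le hs ha (norm_le_three_halves h3 h4) (norm_le_three_halves h5 h6)
    (norm_le_three_halves hre him) hx2
  have hax : ∀ t : ℝ, |t| ≤ s → |a * t| ≤ s := by
    intro t ht
    rw [abs_mul, abs_of_nonneg (by linarith : 0 ≤ a)]
    exact (mul_le_of_le_one_left (abs_nonneg t) h2).trans ht
  have hd0 : 0 ≤ d := by linarith
  have hρs2 : ρ ^ 2 ≤ s ^ 2 / 1024 := by
    have : (32 * ρ) ^ 2 ≤ s ^ 2 := pow_le_pow_left₀ (by positivity) hρs 2
    linarith
  have hds : 3 * s ≤ d * s := mul_le_mul_of_nonneg_right hd hs0.le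
  have hds2 : 3 * s ^ 2 ≤ d * s ^ 2 := mul_le_mul_of_nonneg_right hd (sq_nonneg s)
  have hdρs : d * ρ ≤ d * (s / 32) := mul_le_mul_of_nonneg_left (by linarith) hd0
  have hdρs2 : d * ρ ^ 2 ≤ d * (s ^ 2 / 1024) := mul_le_mul_of_nonneg_left hρs2 hd0
  have hdρs3 : d * ρ * s ≤ d * (s / 32) * s := mul_le_mul_of_nonneg_right hdρs hs0.le
  have hds0 : 0 ≤ d * s ^ 2 := by positivity
  have key1 : ∀ t₁ t₂ t₃ : ℝ, |t₁| ≤ s → |t₂| ≤ d * ρ → |t₃| ≤ s + 27 / 4 * (d * ρ) →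
      |t₁ + t₂ + t₃| ≤ d * s := by
    intro t₁ t₂ t₃ k1 k2 k3
    refine (abs_add_three _ _ _).trans ?_
    linarith
  have key2 : ∀ t₁ t₂ : ℝ, |t₁| ≤ d * ρ ^ 2 →
      |t₂| ≤ 2 * s ^ 2 + 9 / 2 * (d * ρ * s) + 9 / 4 * (d * ρ ^ 2) → |t₁ + t₂| ≤ d * s ^ 2 := by
    intro t₁ t₂ k1 k2
    refine (abs_add_le _ _).trans ?_
    linarith
  refine mem_plank_iff.2 ⟨a, e, _, _, h1, h2, ?_, ?_, ?_, ?_, by linarith, h8,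
    h9.trans ?_, h10.trans (change_of_base_snd (x' := star x) rfl (one_add_ne_zero w))⟩
  · rw [Complex.add_re, Complex.add_re, Complex.re_ofReal_mul]
    exact key1 _ _ _ (hax _ hre) h3 ((Complex.abs_re_le_norm _).trans hb')
  · rw [Complex.add_im, Complex.add_im, Complex.im_ofReal_mul]
    exact key1 _ _ _ (hax _ him) h4 ((Complex.abs_im_le_norm _).trans hb')
  · rw [Complex.add_re]
    exact key2 _ _ h5 ((Complex.abs_re_le_norm _).trans hc')
  · rw [Complex.add_im]
    exact key2 _ _ h6 ((Complex.abs_im_le_norm _).trans hc')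
  · rw [star_add]
    exact change_of_base_fst rfl (one_add_ne_zero w)

theorem norm_sub_le_of_plank_subset {d ρ s : ℝ} {z w : ℂ} (hd : 0 ≤ d) (hρ : 0 ≤ ρ)
    (hs : 0 < s) (hs1 : s ≤ 1) (hw : ‖w‖ ≤ 3) (h : plank d ρ z ⊆ plank d s w) :
    ‖z - w‖ ≤ 14 * d * s := by
  have hmem : cVec z ∈ plank d ρ z := by
    refine ⟨1, 0, 0, 0, 0, 0, by norm_num, le_rfl, ?_, ?_, ?_, ?_, ?_, by simp⟩ <;>
      simp <;> positivity
  obtain ⟨a, e, b, c, -, -, h3, h4, h5, h6, h7, h8, h9, -⟩ := mem_plank_iff.1 (h hmem)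
  have hb := norm_le_three_halves h3 h4
  have hc := norm_le_three_halves h5 h6
  have h8' : (1 : ℝ) = a + e := by simpa [cVec] using h8
  have hf : fstC (cVec z) = z := by apply Complex.ext <;> simp [fstC, cVec]
  have hzw : z - w = b - e * w - 2 * star w * c := by
    have : (a : ℂ) = 1 - e := by rw [eq_sub_iff_add_eq]; exact_mod_cast h8'.symm
    rw [← hf, h9, this]; ring
  have hds : d * s ^ 2 ≤ d * s := by
    have : s ^ 2 ≤ s := by nlinarith
    gcongr
  have e1 : ‖(e : ℂ) * w‖ ≤ d * s ^ 2 * 3 := by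
    rw [norm_mul, Complex.norm_real]; exact mul_le_mul h7 hw (norm_nonneg _) (by positivity)
  have e2 : ‖2 * star w * c‖ ≤ 2 * 3 * (3 / 2 * (d * s ^ 2)) := by
    simp only [norm_mul, Complex.norm_ofNat, norm_star]; gcongr
  rw [hzw]
  refine (norm_sub_le _ _).trans ((add_le_add_left (norm_sub_le _ _) _).trans ?_)
  have : 0 ≤ d * s := by positivity
  linarith

/-- Frequencies dual, up to the factor `H`, to the wave envelope over `w` at scale `ρ / t`. -/
def dualBox (H ρ t : ℝ) (w : ℂ) : Set E5 :=
  {ξ | |ξ 4| ≤ H * t ^ 2 ∧ ‖tangentPoly ξ w‖ ≤ H * (t * ρ) ∧ ‖normalPoly ξ w‖ ≤ H * ρ ^ 2}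

theorem continuous_tangentPoly (z : ℂ) : Continuous fun ξ => tangentPoly ξ z := by
  have h : (fun ξ : E5 => tangentPoly ξ z) =
      fun ξ => (ξ 4 : ℂ) * z - ((ξ 0 : ℂ) + (ξ 1 : ℂ) * Complex.I) := by
    funext ξ; simp [tangentPoly, fstC, Complex.mk_eq_add_mul_I]
  rw [h]; fun_prop

theorem continuous_normalPoly (z : ℂ) : Continuous fun ξ => normalPoly ξ z := by
  have h : (fun ξ : E5 => normalPoly ξ z) =
      fun ξ => ((ξ 2 : ℂ) + (ξ 3 : ℂ) * Complex.I) -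
        2 * z * ((ξ 0 : ℂ) + (ξ 1 : ℂ) * Complex.I) + (ξ 4 : ℂ) * z ^ 2 := by
    funext ξ; simp [normalPoly, fstC, sndC, Complex.mk_eq_add_mul_I]
  rw [h]; fun_prop

theorem measurableSet_dualBox (H ρ t : ℝ) (w : ℂ) : MeasurableSet (dualBox H ρ t w) := by
  refine IsClosed.measurableSet ?_
  refine IsClosed.inter ?_ (IsClosed.inter ?_ ?_)
  · exact isClosed_le (f := fun ξ : E5 => |ξ 4|) (by fun_prop) continuous_const
  · exact isClosed_le (continuous_tangentPoly w).norm continuous_const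
  · exact isClosed_le (continuous_normalPoly w).norm continuous_const

/-- Moving the base point of a dual box by `M` times its scale `ρ / t`. -/
theorem dualBox_subset_dualBox {H M ρ t : ℝ} {z w : ℂ} (hH : 0 ≤ H) (hM : 0 ≤ M) (hρ : 0 ≤ ρ)
    (ht : 0 ≤ t) (hzw : t * ‖z - w‖ ≤ M * ρ) :
    dualBox H ρ t w ⊆ dualBox (H * (1 + M) ^ 2) ρ t z := by
  rintro ξ ⟨h1, h2, h3⟩
  have hM2 : (1 : ℝ) + M ≤ (1 + M) ^ 2 := by nlinarith
  have hM1 : (1 : ℝ) ≤ (1 + M) ^ 2 := by nlinarith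
  have h4 : ‖tangentPoly ξ z - tangentPoly ξ w‖ ≤ H * M * (t * ρ) := by
    rw [tangentPoly_sub, norm_mul, Complex.norm_real, Real.norm_eq_abs]
    calc |ξ 4| * ‖z - w‖ ≤ H * t ^ 2 * ‖z - w‖ := by gcongr
      _ = H * t * (t * ‖z - w‖) := by ring
      _ ≤ H * t * (M * ρ) := by gcongr
      _ = _ := by ring
  have h5 : ‖tangentPoly ξ z‖ ≤ H * (1 + M) * (t * ρ) := by
    have := norm_add_le (tangentPoly ξ z - tangentPoly ξ w) (tangentPoly ξ w)
    rw [sub_add_cancel] at this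
    linarith
  refine ⟨h1.trans ?_, h5.trans ?_, ?_⟩
  · rw [mul_assoc]
    exact mul_le_mul_of_nonneg_left (le_mul_of_one_le_left (sq_nonneg t) hM1) hH
  · gcongr
  · have h6 : ‖normalPoly ξ z - normalPoly ξ w‖ ≤ H * (M * (2 + M)) * ρ ^ 2 := by
      rw [normalPoly_sub, norm_mul]
      have h7 : ‖tangentPoly ξ z + tangentPoly ξ w‖ ≤ H * (2 + M) * (t * ρ) :=
        (norm_add_le _ _).trans (by linarith)
      calc ‖z - w‖ * ‖tangentPoly ξ z + tangentPoly ξ w‖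
          ≤ ‖z - w‖ * (H * (2 + M) * (t * ρ)) := by gcongr
        _ = (t * ‖z - w‖) * (H * (2 + M) * ρ) := by ring
        _ ≤ (M * ρ) * (H * (2 + M) * ρ) := by gcongr
        _ = _ := by ring
    have := norm_add_le (normalPoly ξ z - normalPoly ξ w) (normalPoly ξ w)
    rw [sub_add_cancel] at this
    linarith

theorem abs_inner_le_of_mem_polar {s : Set E5} {x ξ : E5} (hx : x ∈ (innerₗ E5).polar s)
    (hξ : ξ ∈ s) : |inner ℝ x ξ| ≤ 1 := by
  rw [real_inner_comm]
  exact hx ξ hξ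

theorem abs_inner_le_of_mem_polar_plank {d ρ H : ℝ} {z : ℂ} (hd : 1 ≤ d) (hρ : 0 < ρ)
    (hH : 0 ≤ H) {x ξ : E5} (hx : x ∈ (innerₗ E5).polar (plank d ρ z)) (h1 : |ξ 4| ≤ H)
    (h2 : ‖tangentPoly ξ z‖ ≤ H * ρ) (h3 : ‖normalPoly ξ z‖ ≤ H * ρ ^ 2) (hρ1 : ρ ≤ 1) :
    |inner ℝ x ξ| ≤ 13 * H := by
  have hd0 : 0 < d := by linarith
  have hc : |inner ℝ x (cVec z)| ≤ 1 := by
    refine abs_inner_le_of_mem_polar hx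
      ⟨1, 0, 0, 0, 0, 0, by norm_num, le_rfl, ?_, ?_, ?_, ?_, ?_, by simp⟩ <;> simp <;> positivity
  have hsub : ∀ (v : E5) (κ : ℝ), 0 < κ → cVec z + (d * κ) • v ∈ plank d ρ z →
      κ * |inner ℝ x v| ≤ 2 := by
    intro v κ hκ hv
    have e1 := abs_inner_le_of_mem_polar hx hv
    rw [inner_add_right, real_inner_smul_right] at e1
    have e2 : d * κ * |inner ℝ x v| ≤ 2 := by
      rw [← abs_of_pos (mul_pos hd0 hκ), ← abs_mul]
      have := abs_sub (inner ℝ x (cVec z) + d * κ * inner ℝ x v) (inner ℝ x (cVec z))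
      rw [add_sub_cancel_left] at this
      linarith
    have e3 : κ * |inner ℝ x v| ≤ d * (κ * |inner ℝ x v|) :=
      le_mul_of_one_le_left (by positivity) hd
    linarith
  have ht1 := hsub (tVecS z) ρ hρ ⟨1, d * ρ, 0, 0, 0, 0, by norm_num, le_rfl,
    by rw [abs_of_pos (by positivity)], by simp; positivity, by simp; positivity,
    by simp; positivity, by simp; positivity, by simp⟩
  have ht2 := hsub (tVecT z) ρ hρ ⟨1, 0, d * ρ, 0, 0, 0, by norm_num, le_rfl,
    by simp; positivity, by rw [abs_of_pos (by positivity)], by simp; positivity,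
    by simp; positivity, by simp; positivity, by simp⟩
  have hn1 := hsub (nVecS z) (ρ ^ 2) (by positivity) ⟨1, 0, 0, d * ρ ^ 2, 0, 0, by norm_num, le_rfl,
    by simp; positivity, by simp; positivity, by rw [abs_of_pos (by positivity)],
    by simp; positivity, by simp; positivity, by simp⟩
  have hn2 := hsub (nVecT z) (ρ ^ 2) (by positivity) ⟨1, 0, 0, 0, d * ρ ^ 2, 0, by norm_num, le_rfl,
    by simp; positivity, by simp; positivity, by simp; positivity,
    by rw [abs_of_pos (by positivity)], by simp; positivity, by simp⟩
  set L : ℂ := 1 + 4 * z * star z with hL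
  have hL0 : L ≠ 0 := one_add_ne_zero z
  set g : ℂ := normalPoly ξ z / L with hg
  set b : ℂ := 2 * normalPoly ξ z * star z / L - tangentPoly ξ z with hb
  have hgn : ‖g‖ ≤ H * ρ ^ 2 := (norm_div_one_add_le _ _).trans h3
  have hbn : ‖b‖ ≤ 3 / 2 * (H * ρ) := by
    have e1 := norm_mul_star_div_one_add_le (normalPoly ξ z) z
    have e2 : H * ρ ^ 2 ≤ H * ρ := by
      rw [pow_two]; gcongr; exact mul_le_of_le_one_left hρ.le hρ1
    refine (norm_sub_le _ _).trans ?_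
    linarith
  have hξ : ξ = ξ 4 • cVec z + b.re • tVecS z + b.im • tVecT z + g.re • nVecS z + g.im • nVecT z
      + (0 : ℝ) • nVec5 := by
    rw [eq_combination_iff]
    have hgL : g * L = normalPoly ξ z := div_mul_cancel₀ _ hL0
    have hbg : b = 2 * g * star z - tangentPoly ξ z := by rw [hb, hg]; ring
    refine ⟨by simp, ?_, ?_⟩
    · change _ = _ + b - _ * g
      rw [hbg, tangentPoly]; ring
    · change _ = _ + _ * b + g
      rw [hbg]
      have e1 : g + 4 * z * star z * g = normalPoly ξ z := by rw [← hgL, hL]; ring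
      have e2 : (ξ 4 : ℂ) * z ^ 2 + 2 * z * (2 * g * star z - tangentPoly ξ z) + g
          = ξ 4 * z ^ 2 - 2 * z * tangentPoly ξ z + (g + 4 * z * star z * g) := by ring
      rw [e2, e1, tangentPoly, normalPoly]; ring
  have hterm : ∀ (v : E5) (κ β m : ℝ), 0 < κ → 0 ≤ m → κ * |inner ℝ x v| ≤ 2 → |β| ≤ m * κ →
      |inner ℝ x (β • v)| ≤ 2 * m := by
    intro v κ β m hκ hm e1 e2
    rw [real_inner_smul_right, abs_mul]
    calc |β| * |inner ℝ x v| ≤ m * κ * |inner ℝ x v| := by gcongr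
      _ = m * (κ * |inner ℝ x v|) := by ring
      _ ≤ m * 2 := by gcongr
      _ = 2 * m := by ring
  have q0 : |inner ℝ x (ξ 4 • cVec z)| ≤ H := by
    rw [real_inner_smul_right, abs_mul]
    calc |ξ 4| * |inner ℝ x (cVec z)| ≤ H * 1 := by gcongr
      _ = H := mul_one H
  have q1 := hterm _ ρ b.re (3 / 2 * H) hρ (by positivity) ht1
    ((Complex.abs_re_le_norm b).trans (by linarith))
  have q2 := hterm _ ρ b.im (3 / 2 * H) hρ (by positivity) ht2
    ((Complex.abs_im_le_norm b).trans (by linarith))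
  have q3 := hterm _ (ρ ^ 2) g.re H (by positivity) hH hn1 ((Complex.abs_re_le_norm g).trans hgn)
  have q4 := hterm _ (ρ ^ 2) g.im H (by positivity) hH hn2 ((Complex.abs_im_le_norm g).trans hgn)
  rw [hξ]
  simp only [inner_add_right, zero_smul, add_zero]
  refine (abs_add_le _ _).trans ?_
  have r1 := abs_add_three (inner ℝ x (ξ 4 • cVec z)) (inner ℝ x (b.re • tVecS z))
    (inner ℝ x (b.im • tVecT z))
  have r2 := abs_add_le (inner ℝ x (ξ 4 • cVec z) + inner ℝ x (b.re • tVecS z) +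
    inner ℝ x (b.im • tVecT z)) (inner ℝ x (g.re • nVecS z))
  linarith

theorem isBounded_plank (d ρ : ℝ) (z : ℂ) : Bornology.IsBounded (plank d ρ z) := by
  refine isBounded_iff_forall_norm_le.2 ⟨‖cVec z‖ + d * ρ * ‖tVecS z‖ + d * ρ * ‖tVecT z‖ +
    d * ρ ^ 2 * ‖nVecS z‖ + d * ρ ^ 2 * ‖nVecT z‖ + d * ρ ^ 2 * ‖nVec5‖, ?_⟩
  rintro _ ⟨a, b₁, b₂, c₁, c₂, e, h1, h2, h3, h4, h5, h6, h7, rfl⟩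
  have hsm : ∀ (t m : ℝ) (v : E5), |t| ≤ m → ‖t • v‖ ≤ m * ‖v‖ := by
    intro t m v h
    rw [norm_smul]
    exact mul_le_mul_of_nonneg_right h (norm_nonneg v)
  have ha : ‖a • cVec z‖ ≤ 1 * ‖cVec z‖ := hsm _ _ _ (abs_le.2 ⟨by linarith, h2⟩)
  rw [one_mul] at ha
  exact norm_add_le_of_le (norm_add_le_of_le (norm_add_le_of_le (norm_add_le_of_le
    (norm_add_le_of_le ha (hsm _ _ _ h3)) (hsm _ _ _ h4)) (hsm _ _ _ h5)) (hsm _ _ _ h6))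
    (hsm _ _ _ h7)

theorem isBounded_polar_plank {d ρ : ℝ} {z : ℂ} (hd : 1 ≤ d) (hρ : 0 < ρ) (hρ1 : ρ ≤ 1) :
    Bornology.IsBounded ((innerₗ E5).polar (plank d ρ z)) := by
  have hcoord : ∀ i : Fin 5, ∃ M : ℝ, ∀ x ∈ (innerₗ E5).polar (plank d ρ z), |x i| ≤ M := by
    intro i
    set ξ : E5 := EuclideanSpace.single i 1
    set H : ℝ := |ξ 4| + ‖tangentPoly ξ z‖ / ρ + ‖normalPoly ξ z‖ / ρ ^ 2 with hH
    have p1 : 0 ≤ |ξ 4| := abs_nonneg _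
    have p2 : 0 ≤ ‖tangentPoly ξ z‖ / ρ := by positivity
    have p3 : 0 ≤ ‖normalPoly ξ z‖ / ρ ^ 2 := by positivity
    refine ⟨13 * H, fun x hx => ?_⟩
    have := abs_inner_le_of_mem_polar_plank hd hρ (by linarith : 0 ≤ H) hx (ξ := ξ) (by linarith)
      (by rw [← div_le_iff₀ hρ]; linarith) (by rw [← div_le_iff₀ (by positivity)]; linarith) hρ1
    simpa [ξ, EuclideanSpace.inner_single_right] using this
  choose M hM using hcoord
  refine isBounded_iff_forall_norm_le.2 ⟨∑ i, M i, fun x hx => ?_⟩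
  calc ‖x‖ = ‖∑ i, x i • EuclideanSpace.single i (1 : ℝ)‖ := by
        congr 1
        ext j
        simp [Pi.single_apply]
    _ ≤ ∑ i, ‖x i • EuclideanSpace.single i (1 : ℝ)‖ := norm_sum_le _ _
    _ ≤ ∑ i, M i := by
        refine Finset.sum_le_sum fun i _ => ?_
        simpa [norm_smul] using hM i x hx

theorem zero_mem_interior_polar {s : Set E5} (hs : Bornology.IsBounded s) :
    0 ∈ interior ((innerₗ E5).polar s) := by
  obtain ⟨R, hR0, hR⟩ := hs.exists_pos_norm_le
  rw [mem_interior_iff_mem_nhds]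
  refine Filter.mem_of_superset (Metric.ball_mem_nhds 0 (inv_pos.2 hR0)) fun x hx => ?_
  intro ξ hξ
  rw [mem_ball_zero_iff] at hx
  calc ‖inner ℝ ξ x‖ ≤ ‖ξ‖ * ‖x‖ := norm_inner_le_norm ξ x
    _ ≤ R * R⁻¹ := by gcongr; exact hR ξ hξ
    _ = 1 := mul_inv_cancel₀ hR0.ne'

theorem neg_polar (s : Set E5) : -(innerₗ E5).polar s = (innerₗ E5).polar s := by
  ext x
  simp [LinearMap.polar]

section WaveEnvelope

variable {d r s : ℝ} {w : ℂ}

theorem neg_waveEnvelope : -waveEnvelope d r s w = waveEnvelope d r s w := by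
  simp only [waveEnvelope, ← convexHull_neg, Set.iUnion_neg, neg_polar]

theorem isBounded_waveEnvelope (hd : 1 ≤ d) (hr : 1 ≤ r) :
    Bornology.IsBounded (waveEnvelope d r s w) := by
  refine (isBounded_convexHull).2 ?_
  exact (Bornology.isBounded_biUnion_finset _).2 fun k _ =>
    isBounded_polar_plank hd (by positivity) (inv_le_one_of_one_le₀ hr)

theorem zero_mem_interior_waveEnvelope (h : (subPlanks d r s w).Nonempty) :
    0 ∈ interior (waveEnvelope d r s w) := by
  obtain ⟨k, hk⟩ := h
  refine interior_mono ?_ (zero_mem_interior_polar (isBounded_plank d r⁻¹ (node r⁻¹ k)))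
  exact (Set.subset_biUnion_of_mem (u := fun k => (innerₗ E5).polar (plank d r⁻¹ (node r⁻¹ k)))
    hk).trans (subset_convexHull ℝ _)

theorem plank_subset_of_mem_subPlanks {k : ℤ × ℤ} (hk : k ∈ subPlanks d r s w) :
    plank d r⁻¹ (node r⁻¹ k) ⊆ plank d s w := by
  classical
  simp only [subPlanks, Finset.mem_filter] at hk
  exact hk.2

theorem abs_inner_le_of_mem_waveEnvelope {H t : ℝ} (hd : 1 ≤ d) (hr : 1 ≤ r) (hs : 0 < s)
    (hs1 : s ≤ 1) (hw : ‖w‖ ≤ 3) (hH : 0 ≤ H) (ht : t * s = r⁻¹) (ht0 : 0 ≤ t) (ht1 : t ≤ 1)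
    {ξ x : E5} (hξ : ξ ∈ dualBox H r⁻¹ t w) (hx : x ∈ waveEnvelope d r s w) :
    |inner ℝ x ξ| ≤ 13 * (H * (1 + 14 * d) ^ 2) := by
  have hr0 : 0 < r⁻¹ := by positivity
  have hconv : Convex ℝ {x : E5 | |inner ℝ x ξ| ≤ 13 * (H * (1 + 14 * d) ^ 2)} := by
    have : {x : E5 | |inner ℝ x ξ| ≤ 13 * (H * (1 + 14 * d) ^ 2)} =
        (fun x => inner ℝ x ξ) ⁻¹' Set.Icc (-(13 * (H * (1 + 14 * d) ^ 2)))
          (13 * (H * (1 + 14 * d) ^ 2)) := by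
      ext x; simp [abs_le]
    rw [this]
    refine (convex_Icc _ _).is_linear_preimage ⟨fun x y => inner_add_left x y ξ, fun c x => ?_⟩
    rw [real_inner_smul_left, smul_eq_mul]
  refine convexHull_min ?_ hconv hx
  refine Set.iUnion₂_subset fun k hk y hy => ?_
  have hsub := plank_subset_of_mem_subPlanks hk
  have hdist := norm_sub_le_of_plank_subset (by linarith) hr0.le hs hs1 hw hsub
  obtain ⟨h1, h2, h3⟩ := dualBox_subset_dualBox (z := node r⁻¹ k) (M := 14 * d) hH (by linarith)
    hr0.le ht0 (by
      calc t * ‖node r⁻¹ k - w‖ ≤ t * (14 * d * s) := by gcongr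
        _ = 14 * d * (t * s) := by ring
        _ = 14 * d * r⁻¹ := by rw [ht]) hξ
  have hH' : 0 ≤ H * (1 + 14 * d) ^ 2 := by positivity
  refine abs_inner_le_of_mem_polar_plank hd hr0 hH' hy (h1.trans ?_) (h2.trans ?_) h3
    (inv_le_one_of_one_le₀ hr)
  · exact mul_le_of_le_one_right hH' (pow_le_one₀ ht0 ht1)
  · gcongr
    exact mul_le_of_le_one_left hr0.le ht1

end WaveEnvelope

theorem norm_node_le {ρ : ℝ} (hρ : 0 < ρ) {k : ℤ × ℤ} (hk : k ∈ grid ρ) : ‖node ρ k‖ ≤ 3 := by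
  have h := (mem_grid hρ k).1 hk
  have := norm_le_three_halves h.1 h.2
  linarith

/-- The index at scale `2 ^ j / r` of the parent of the plank with index `k` at scale `1 / r`. -/
def parent (j : ℕ) (k : ℤ × ℤ) : ℤ × ℤ := (k.1.tdiv (2 ^ j), k.2.tdiv (2 ^ j))

theorem abs_tdiv_mul_le (m b : ℤ) : |m.tdiv b * b| ≤ |m| := by
  rw [mul_comm, Int.abs_eq_natAbs, Int.abs_eq_natAbs, Int.natAbs_mul, Int.natAbs_tdiv]
  exact_mod_cast Nat.mul_div_le _ _

theorem abs_sub_tdiv_mul_le (m : ℤ) {b : ℤ} (hb : 0 < b) : |m - m.tdiv b * b| ≤ b := by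
  have h : m - m.tdiv b * b = m.tmod b := by rw [Int.tmod_def]; ring
  rw [h]
  have h1 := Int.lt_tmod_of_pos m hb
  have h2 := Int.tmod_lt_of_pos m hb
  rw [abs_le]
  constructor <;> linarith

theorem abs_scale_mul_tdiv_le {r : ℝ} (hr : 0 < r) (j : ℕ) (m : ℤ) :
    |(2 : ℝ) ^ j / r * (m.tdiv (2 ^ j) : ℤ)| ≤ |r⁻¹ * m| := by
  have h : |((m.tdiv (2 ^ j) : ℤ) : ℝ) * 2 ^ j| ≤ |(m : ℝ)| := by
    exact_mod_cast abs_tdiv_mul_le m (2 ^ j)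
  calc |(2 : ℝ) ^ j / r * (m.tdiv (2 ^ j) : ℤ)|
      = |r⁻¹ * (((m.tdiv (2 ^ j) : ℤ) : ℝ) * 2 ^ j)| := by
        congr 1; ring
    _ = r⁻¹ * |((m.tdiv (2 ^ j) : ℤ) : ℝ) * 2 ^ j| := by
        rw [abs_mul, abs_of_pos (inv_pos.2 hr)]
    _ ≤ r⁻¹ * |(m : ℝ)| := by gcongr
    _ = |r⁻¹ * m| := by rw [abs_mul, abs_of_pos (inv_pos.2 hr)]

theorem abs_sub_scale_mul_tdiv_le {r : ℝ} (hr : 0 < r) (j : ℕ) (m : ℤ) :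
    |r⁻¹ * m - (2 : ℝ) ^ j / r * (m.tdiv (2 ^ j) : ℤ)| ≤ 2 ^ j / r := by
  have h : |(m : ℝ) - ((m.tdiv (2 ^ j) : ℤ) : ℝ) * 2 ^ j| ≤ 2 ^ j := by
    exact_mod_cast abs_sub_tdiv_mul_le m (b := 2 ^ j) (by positivity)
  calc |r⁻¹ * m - (2 : ℝ) ^ j / r * (m.tdiv (2 ^ j) : ℤ)|
      = |r⁻¹ * ((m : ℝ) - ((m.tdiv (2 ^ j) : ℤ) : ℝ) * 2 ^ j)| := by
        congr 1; ring
    _ = r⁻¹ * |(m : ℝ) - ((m.tdiv (2 ^ j) : ℤ) : ℝ) * 2 ^ j| := by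
        rw [abs_mul, abs_of_pos (inv_pos.2 hr)]
    _ ≤ r⁻¹ * 2 ^ j := by gcongr
    _ = 2 ^ j / r := by ring

theorem parent_mem_grid {r : ℝ} (hr : 0 < r) (j : ℕ) {k : ℤ × ℤ} (hk : k ∈ grid r⁻¹) :
    parent j k ∈ grid (2 ^ j / r) := by
  rw [mem_grid (by positivity)] at hk ⊢
  exact ⟨(abs_scale_mul_tdiv_le hr j k.1).trans hk.1, (abs_scale_mul_tdiv_le hr j k.2).trans hk.2⟩

theorem abs_re_node_sub_parent_le {r : ℝ} (hr : 0 < r) (j : ℕ) (k : ℤ × ℤ) :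
    |(node r⁻¹ k - node (2 ^ j / r) (parent j k)).re| ≤ 2 ^ j / r :=
  abs_sub_scale_mul_tdiv_le hr j k.1

theorem abs_im_node_sub_parent_le {r : ℝ} (hr : 0 < r) (j : ℕ) (k : ℤ × ℤ) :
    |(node r⁻¹ k - node (2 ^ j / r) (parent j k)).im| ≤ 2 ^ j / r :=
  abs_sub_scale_mul_tdiv_le hr j k.2

theorem norm_node_sub_parent_le {r : ℝ} (hr : 0 < r) (j : ℕ) (k : ℤ × ℤ) :
    ‖node r⁻¹ k - node (2 ^ j / r) (parent j k)‖ ≤ 3 / 2 * (2 ^ j / r) :=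
  norm_le_three_halves (abs_re_node_sub_parent_le hr j k) (abs_im_node_sub_parent_le hr j k)

theorem mem_subPlanks_parent {d r : ℝ} (hd : 3 ≤ d) (hr : 1 ≤ r) {j : ℕ} (hj : j = 0 ∨ 5 ≤ j)
    (hjr : (2 : ℝ) ^ j / r ≤ 1) {k : ℤ × ℤ} (hk : k ∈ grid r⁻¹) :
    k ∈ subPlanks d r (2 ^ j / r) (node (2 ^ j / r) (parent j k)) := by
  classical
  have hr0 : 0 < r := by linarith
  simp only [subPlanks, Finset.mem_filter]
  refine ⟨hk, ?_⟩
  rcases hj with rfl | hj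
  · simp [parent]
  · refine plank_subset_plank hd (inv_pos.2 hr0) ?_ hjr (abs_re_node_sub_parent_le hr0 j k)
      (abs_im_node_sub_parent_le hr0 j k)
    have : (2 : ℝ) ^ 5 ≤ 2 ^ j := pow_le_pow_right₀ (by norm_num) hj
    rw [div_eq_mul_inv]
    gcongr
    linarith

/-- Every plank contains the plank of scale `1 / r` over its own base point. -/
theorem subPlanks_nonempty {d r : ℝ} (hd : 0 ≤ d) (hr : 1 ≤ r) (j : ℕ) {k : ℤ × ℤ}
    (hk : k ∈ grid (2 ^ j / r)) : (subPlanks d r (2 ^ j / r) (node (2 ^ j / r) k)).Nonempty := by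
  classical
  have hr0 : 0 < r := by linarith
  have hnode : node r⁻¹ (2 ^ j * k.1, 2 ^ j * k.2) = node (2 ^ j / r) k := by
    apply Complex.ext <;> simp [node] <;> ring
  refine ⟨(2 ^ j * k.1, 2 ^ j * k.2), ?_⟩
  simp only [subPlanks, Finset.mem_filter]
  refine ⟨?_, ?_⟩
  · rw [mem_grid (by positivity), hnode]
    exact (mem_grid (by positivity) k).1 hk
  · rw [hnode]
    have hle : r⁻¹ ≤ 2 ^ j / r := by
      rw [div_eq_mul_inv]
      exact le_mul_of_one_le_left (by positivity) (one_le_pow₀ (by norm_num))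
    have h1 : d * r⁻¹ ≤ d * (2 ^ j / r) := by gcongr
    have h2 : d * r⁻¹ ^ 2 ≤ d * (2 ^ j / r) ^ 2 := by gcongr
    rintro _ ⟨a, b₁, b₂, c₁, c₂, e, k1, k2, k3, k4, k5, k6, k7, k8⟩
    exact ⟨a, b₁, b₂, c₁, c₂, e, k1, k2, k3.trans h1, k4.trans h1, k5.trans h2, k6.trans h2,
      k7.trans h2, k8⟩

/-- The choice of the scale of a frequency: `m` is the normalised size of `h` and of the
discriminant, and the scale is `2 ^ j / r` with `m ≈ 4 ^ (-j)`, apart from boundary effects. -/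
theorem exists_scale {r : ℝ} (hr : 1 ≤ r) (m : ℝ) :
    ∃ j : ℕ, (2 : ℝ) ^ j / r ≤ 1 ∧ (j = 0 ∨ 5 ≤ j ∧ m ≤ (2⁻¹ ^ j) ^ 2) ∧
      (r ≤ 32 * 2 ^ j ∨ (2⁻¹ ^ j) ^ 2 / 1024 ≤ m) := by
  have hr0 : 0 < r := by linarith
  by_cases h32 : r ≤ 32
  · exact ⟨0, by simpa using inv_le_one_of_one_le₀ hr, Or.inl rfl, Or.inl (by simpa using h32)⟩
  by_cases hm : (1 : ℝ) / 1024 ≤ m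
  · exact ⟨0, by simpa using inv_le_one_of_one_le₀ hr, Or.inl rfl, Or.inr (by simpa using hm)⟩
  push Not at h32 hm
  let good : ℕ → Prop := fun i => (2 : ℝ) ^ (5 + i) ≤ r ∧ m ≤ (2⁻¹ ^ (5 + i)) ^ 2
  have h0 : good 0 := ⟨by norm_num; linarith, by norm_num; linarith⟩
  have hex : ∃ i, ¬ good i := by
    obtain ⟨n, hn⟩ := pow_unbounded_of_one_lt r (by norm_num : (1 : ℝ) < 2)
    refine ⟨n, fun h => ?_⟩
    have : (2 : ℝ) ^ n ≤ 2 ^ (5 + n) := pow_le_pow_right₀ (by norm_num) (by omega)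
    linarith [h.1]
  classical
  obtain ⟨i, hi, hi'⟩ : ∃ i, good i ∧ ¬ good (i + 1) := by
    by_contra! hcon
    obtain ⟨n, hn⟩ := hex
    exact hn (Nat.rec h0 hcon n)
  refine ⟨5 + i, by rw [div_le_one hr0]; exact hi.1, Or.inr ⟨by omega, hi.2⟩, ?_⟩
  by_contra! hcon
  refine hi' ⟨?_, ?_⟩
  · rw [← add_assoc, pow_succ]
    have : (0 : ℝ) < 2 ^ (5 + i) := by positivity
    linarith [hcon.1]
  · rw [← add_assoc, pow_succ (2⁻¹ : ℝ) (5 + i), mul_pow]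
    have : (0 : ℝ) ≤ (2⁻¹ ^ (5 + i)) ^ 2 := by positivity
    linarith [hcon.2]

/-- The frequency `ξ` is in the difference set of the plank over `z`, up to a constant factor. -/
def NearPlank (C ρ : ℝ) (ξ : E5) (z : ℂ) : Prop :=
  |ξ 4| ≤ C ∧ ‖tangentPoly ξ z‖ ≤ C * ρ ∧ ‖normalPoly ξ z‖ ≤ C * ρ ^ 2

/-- The normalised size of the frequency `ξ`. -/
noncomputable def freqSize (ρ : ℝ) (ξ : E5) : ℝ := |ξ 4| + ‖discr ξ‖ / ρ ^ 2

theorem NearPlank.mem_dualBox {C ρ t : ℝ} {ξ : E5} {z : ℂ} (hC : 1 ≤ C) (hρ : 0 < ρ) (ht : 0 < t)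
    (h : NearPlank C ρ ξ z) (ht1 : t = 1 ∨ freqSize ρ ξ ≤ t ^ 2) :
    ξ ∈ dualBox (2 * C) ρ t z := by
  obtain ⟨h1, h2, h3⟩ := h
  have hC0 : 0 < C := by linarith
  rcases ht1 with rfl | hM
  · refine ⟨?_, ?_, ?_⟩
    · linarith
    · have : 0 < C * ρ := by positivity
      linarith
    · have : 0 < C * ρ ^ 2 := by positivity
      linarith
  · have hp : 0 ≤ ‖discr ξ‖ / ρ ^ 2 := by positivity
    have h4 : |ξ 4| ≤ t ^ 2 := by
      rw [freqSize] at hM; linarith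
    have h5 : ‖discr ξ‖ ≤ t ^ 2 * ρ ^ 2 := by
      rw [← div_le_iff₀ (by positivity)]
      have := abs_nonneg (ξ 4)
      rw [freqSize] at hM; linarith
    refine ⟨?_, ?_, ?_⟩
    · exact h4.trans (le_mul_of_one_le_left (sq_nonneg t) (by linarith))
    · have h6 : ‖tangentPoly ξ z‖ ^ 2 ≤ (2 * C * (t * ρ)) ^ 2 := by
        rw [← norm_pow, tangentPoly_sq]
        refine (norm_add_le _ _).trans ?_
        rw [norm_mul, Complex.norm_real, Real.norm_eq_abs]
        have h7 : |ξ 4| * ‖normalPoly ξ z‖ ≤ t ^ 2 * (C * ρ ^ 2) := by gcongr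
        have h8 : 0 ≤ t ^ 2 * ρ ^ 2 := by positivity
        have h9 : t ^ 2 * ρ ^ 2 * (1 + C) ≤ t ^ 2 * ρ ^ 2 * (4 * C ^ 2) :=
          mul_le_mul_of_nonneg_left (by nlinarith) h8
        linarith
      exact (sq_le_sq₀ (norm_nonneg _) (by positivity)).1 h6
    · have : 0 < C * ρ ^ 2 := by positivity
      linarith

/-- Among three base points whose planks see the same frequency, two are close. -/
theorem NearPlank.not_separated {C ρ t : ℝ} {ξ : E5} {z₁ z₂ z₃ : ℂ} (hC : 1 ≤ C) (hρ : 0 < ρ)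
    (ht : 0 < t) (h₁ : NearPlank C ρ ξ z₁) (h₂ : NearPlank C ρ ξ z₂) (h₃ : NearPlank C ρ ξ z₃)
    (hM : t ^ 2 / 1024 ≤ freqSize ρ ξ) (h₁₂ : 150 * C * ρ ≤ t * ‖z₁ - z₂‖)
    (h₁₃ : 150 * C * ρ ≤ t * ‖z₁ - z₃‖) (h₂₃ : 150 * C * ρ ≤ t * ‖z₂ - z₃‖) : False := by
  have hC0 : 0 < C := by linarith
  have hadd : ∀ z w : ℂ, NearPlank C ρ ξ z → NearPlank C ρ ξ w →
      150 * C * ρ ≤ t * ‖z - w‖ → ‖tangentPoly ξ z + tangentPoly ξ w‖ ≤ t * ρ / 75 := by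
    intro z w hz hw hzw
    have e1 : ‖z - w‖ * ‖tangentPoly ξ z + tangentPoly ξ w‖ ≤ 2 * (C * ρ ^ 2) := by
      rw [← norm_mul, ← normalPoly_sub]
      exact (norm_sub_le _ _).trans (by linarith [hz.2.2, hw.2.2])
    have e2 : 150 * C * ρ * ‖tangentPoly ξ z + tangentPoly ξ w‖ ≤ 150 * C * ρ * (t * ρ / 75) := by
      calc _ ≤ t * ‖z - w‖ * ‖tangentPoly ξ z + tangentPoly ξ w‖ := by gcongr
        _ = t * (‖z - w‖ * ‖tangentPoly ξ z + tangentPoly ξ w‖) := by ring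
        _ ≤ t * (2 * (C * ρ ^ 2)) := by gcongr
        _ = _ := by ring
    exact le_of_mul_le_mul_left e2 (by positivity)
  have a₁₂ := hadd z₁ z₂ h₁ h₂ h₁₂
  have a₁₃ := hadd z₁ z₃ h₁ h₃ h₁₃
  have a₂₃ := hadd z₂ z₃ h₂ h₃ h₂₃
  have b₁ : ‖2 * tangentPoly ξ z₁‖ ≤ 3 * (t * ρ / 75) := by
    have e : 2 * tangentPoly ξ z₁ = (tangentPoly ξ z₁ + tangentPoly ξ z₂) +
      (tangentPoly ξ z₁ + tangentPoly ξ z₃) - (tangentPoly ξ z₂ + tangentPoly ξ z₃) := by ring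
    rw [e]
    refine (norm_sub_le _ _).trans ((add_le_add_left (norm_add_le _ _) _).trans ?_)
    linarith
  have b₂ : ‖2 * tangentPoly ξ z₂‖ ≤ 3 * (t * ρ / 75) := by
    have e : 2 * tangentPoly ξ z₂ = (tangentPoly ξ z₁ + tangentPoly ξ z₂) +
      (tangentPoly ξ z₂ + tangentPoly ξ z₃) - (tangentPoly ξ z₁ + tangentPoly ξ z₃) := by ring
    rw [e]
    refine (norm_sub_le _ _).trans ((add_le_add_left (norm_add_le _ _) _).trans ?_)
    linarith
  rw [norm_mul, Complex.norm_ofNat] at b₁ b₂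
  have hh : |ξ 4| ≤ t ^ 2 / (3750 * C) := by
    have e1 : |ξ 4| * ‖z₁ - z₂‖ ≤ t * ρ / 25 := by
      rw [← Real.norm_eq_abs, ← Complex.norm_real, ← norm_mul, ← tangentPoly_sub]
      exact (norm_sub_le _ _).trans (by linarith)
    have e2 : 150 * C * ρ * |ξ 4| ≤ 150 * C * ρ * (t ^ 2 / (3750 * C)) := by
      calc _ ≤ t * ‖z₁ - z₂‖ * |ξ 4| := by gcongr
        _ = t * (|ξ 4| * ‖z₁ - z₂‖) := by ring
        _ ≤ t * (t * ρ / 25) := by gcongr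
        _ = _ := by field_simp; norm_num
    exact le_of_mul_le_mul_left e2 (by positivity)
  have hD : ‖discr ξ‖ ≤ (t * ρ / 50) ^ 2 + t ^ 2 / 3750 * ρ ^ 2 := by
    have e1 : discr ξ = tangentPoly ξ z₁ ^ 2 - ξ 4 * normalPoly ξ z₁ := by
      rw [tangentPoly_sq]; ring
    rw [e1]
    refine (norm_sub_le _ _).trans ?_
    rw [norm_pow, norm_mul, Complex.norm_real, Real.norm_eq_abs]
    have e2 : |ξ 4| * ‖normalPoly ξ z₁‖ ≤ t ^ 2 / (3750 * C) * (C * ρ ^ 2) := by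
      gcongr; exact h₁.2.2
    have e3 : t ^ 2 / (3750 * C) * (C * ρ ^ 2) = t ^ 2 / 3750 * ρ ^ 2 := by field_simp
    have e4 : ‖tangentPoly ξ z₁‖ ≤ t * ρ / 50 := by linarith
    have e5 : ‖tangentPoly ξ z₁‖ ^ 2 ≤ (t * ρ / 50) ^ 2 := by gcongr
    linarith
  have hD' : ‖discr ξ‖ / ρ ^ 2 ≤ t ^ 2 / 2500 + t ^ 2 / 3750 := by
    rw [div_le_iff₀ (by positivity)]
    refine hD.trans (le_of_eq ?_)
    ring
  have hh' : |ξ 4| ≤ t ^ 2 / 3750 := by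
    refine hh.trans ?_
    gcongr
    linarith
  have : 0 < t ^ 2 := by positivity
  rw [freqSize] at hM
  linarith

/-- A finite family without three pairwise separated members is covered by two balls. -/
theorem exists_two_balls {ι : Type*} (Z : Finset ι) (u : ι → ℂ) (R : ℝ) (hZ : Z.Nonempty)
    (h : ∀ a ∈ Z, ∀ b ∈ Z, ∀ c ∈ Z, R ≤ ‖u a - u b‖ → R ≤ ‖u a - u c‖ → R ≤ ‖u b - u c‖ → False) :
    ∃ a ∈ Z, ∃ b ∈ Z, ∀ c ∈ Z, ‖u a - u c‖ < R ∨ ‖u b - u c‖ < R := by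
  obtain ⟨a, ha⟩ := hZ
  by_cases hb : ∃ b ∈ Z, R ≤ ‖u a - u b‖
  · obtain ⟨b, hb, hab⟩ := hb
    refine ⟨a, ha, b, hb, fun c hc => ?_⟩
    by_contra! hcon
    exact h a ha b hb c hc hab hcon.1 hcon.2
  · push Not at hb
    exact ⟨a, ha, a, ha, fun c hc => Or.inl (hb c hc)⟩

/-- A bound for the number of planks of the scale of a frequency that see this frequency. -/
noncomputable def parentBound (C : ℝ) : ℕ := 129 ^ 2 + 2 * (2 * ⌈150 * C + 3⌉₊ + 1) ^ 2

theorem card_grid_le {s : ℝ} (hs : 2 / s ≤ 64) : (grid s).card ≤ 129 ^ 2 := by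
  have hfl : ⌊2 / s⌋ ≤ 64 := by
    have := Int.floor_le_floor hs
    simpa using this
  have hc : (Finset.Icc (-⌊2 / s⌋) ⌊2 / s⌋).card ≤ 129 := by
    rw [Int.card_Icc]; omega
  rw [grid, Finset.card_product, pow_two]
  exact Nat.mul_le_mul hc hc

theorem mem_Icc_of_norm_node_sub_le {s M : ℝ} (hs : 0 < s) {k l : ℤ × ℤ}
    (h : ‖node s k - node s l‖ ≤ M * s) :
    l ∈ Finset.Icc (k.1 - ⌈M⌉₊) (k.1 + ⌈M⌉₊) ×ˢ Finset.Icc (k.2 - ⌈M⌉₊) (k.2 + ⌈M⌉₊) := by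
  have key : ∀ a b : ℤ, |s * a - s * b| ≤ M * s → b ∈ Finset.Icc (a - ⌈M⌉₊) (a + ⌈M⌉₊) := by
    intro a b hab
    have h1 : |((a - b : ℤ) : ℝ)| ≤ M := by
      rw [← mul_sub, abs_mul, abs_of_pos hs, mul_comm] at hab
      push_cast
      exact le_of_mul_le_mul_right hab hs
    have h2 : |((a - b : ℤ) : ℝ)| ≤ ((⌈M⌉₊ : ℤ) : ℝ) := h1.trans (by exact_mod_cast Nat.le_ceil M)
    have h3 : |a - b| ≤ (⌈M⌉₊ : ℤ) := by exact_mod_cast h2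
    rw [abs_le] at h3
    rw [Finset.mem_Icc]
    omega
  rw [Finset.mem_product]
  exact ⟨key _ _ ((Complex.abs_re_le_norm _).trans h), key _ _ ((Complex.abs_im_le_norm _).trans h)⟩

theorem card_image_parent_le {C r : ℝ} (hC : 1 ≤ C) (hr : 1 ≤ r) {j : ℕ} {ξ : E5}
    (hj : r ≤ 32 * 2 ^ j ∨ (2⁻¹ ^ j) ^ 2 / 1024 ≤ freqSize r⁻¹ ξ) {Z : Finset (ℤ × ℤ)}
    (hZ : ∀ k ∈ Z, k ∈ grid r⁻¹ ∧ NearPlank C r⁻¹ ξ (node r⁻¹ k)) :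
    (Z.image (parent j)).card ≤ parentBound C := by
  have hr0 : 0 < r := by linarith
  rcases hj with hj | hj
  · have h1 : Z.image (parent j) ⊆ grid (2 ^ j / r) := by
      intro m hm
      obtain ⟨k, hk, rfl⟩ := Finset.mem_image.1 hm
      exact parent_mem_grid hr0 j (hZ k hk).1
    refine (Finset.card_le_card h1).trans ((card_grid_le ?_).trans (Nat.le_add_right _ _))
    rw [div_div_eq_mul_div, div_le_iff₀ (by positivity)]
    linarith
  rcases Z.eq_empty_or_nonempty with rfl | hne
  · simp
  set s : ℝ := 2 ^ j / r with hs
  have hs0 : 0 < s := by positivity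
  have hts : (2⁻¹ : ℝ) ^ j * s = r⁻¹ := by
    rw [hs, inv_pow]; field_simp
  obtain ⟨a, ha, b, hb, hab⟩ := exists_two_balls Z (node r⁻¹) (150 * C * s) hne (by
    intro a ha b hb c hc h1 h2 h3
    have hmul : ∀ y : ℝ, 150 * C * s ≤ y → 150 * C * r⁻¹ ≤ 2⁻¹ ^ j * y := by
      intro y hy
      calc 150 * C * r⁻¹ = 2⁻¹ ^ j * (150 * C * s) := by rw [← hts]; ring
        _ ≤ _ := by gcongr
    exact NearPlank.not_separated hC (inv_pos.2 hr0) (by positivity) (hZ a ha).2 (hZ b hb).2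
      (hZ c hc).2 hj (hmul _ h1) (hmul _ h2) (hmul _ h3))
  set M : ℝ := 150 * C + 3 with hM
  let box : ℤ × ℤ → Finset (ℤ × ℤ) := fun k =>
    Finset.Icc (k.1 - ⌈M⌉₊) (k.1 + ⌈M⌉₊) ×ˢ Finset.Icc (k.2 - ⌈M⌉₊) (k.2 + ⌈M⌉₊)
  have hbox : ∀ k, (box k).card = (2 * ⌈M⌉₊ + 1) ^ 2 := by
    intro k
    have : ∀ x : ℤ, (Finset.Icc (x - ⌈M⌉₊) (x + ⌈M⌉₊)).card = 2 * ⌈M⌉₊ + 1 := by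
      intro x; rw [Int.card_Icc]; omega
    rw [Finset.card_product, this, this, pow_two]
  have hnear : ∀ k l, ‖node r⁻¹ k - node r⁻¹ l‖ < 150 * C * s → parent j l ∈ box (parent j k) := by
    intro k l hkl
    refine mem_Icc_of_norm_node_sub_le hs0 ?_
    have e1 := norm_node_sub_parent_le hr0 j k
    have e2 := norm_node_sub_parent_le hr0 j l
    have e3 : node s (parent j k) - node s (parent j l) =
        (node r⁻¹ k - node r⁻¹ l) - (node r⁻¹ k - node s (parent j k)) +
          (node r⁻¹ l - node s (parent j l)) := by ring
    rw [e3]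
    refine (norm_add_le _ _).trans ((add_le_add_left (norm_sub_le _ _) _).trans ?_)
    rw [← hs] at e1 e2
    linarith
  have hsub : Z.image (parent j) ⊆ box (parent j a) ∪ box (parent j b) := by
    intro m hm
    obtain ⟨k, hk, rfl⟩ := Finset.mem_image.1 hm
    rw [Finset.mem_union]
    exact (hab k hk).imp (hnear a k) (hnear b k)
  refine (Finset.card_le_card hsub).trans ((Finset.card_union_le _ _).trans ?_)
  rw [hbox, hbox, parentBound, ← hM]
  omega

/-- The frequency decomposition: for every frequency there is a scale at which boundedly many
parents see it, and for these the frequency is in the dual box. -/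
theorem exists_scale_decomposition {C r : ℝ} (hC : 1 ≤ C) (hr : 1 ≤ r) (ξ : E5)
    {Z : Finset (ℤ × ℤ)} (hZ : ∀ k ∈ Z, k ∈ grid r⁻¹ ∧ NearPlank C r⁻¹ ξ (node r⁻¹ k)) :
    ∃ j : ℕ, (2 : ℝ) ^ j / r ≤ 1 ∧ (j = 0 ∨ 5 ≤ j) ∧
      (Z.image (parent j)).card ≤ parentBound C ∧
      ∀ k ∈ Z, ξ ∈ dualBox (2 * C * (1 + 3 / 2) ^ 2) r⁻¹ (2⁻¹ ^ j)
        (node (2 ^ j / r) (parent j k)) := by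
  have hr0 : 0 < r := by linarith
  obtain ⟨j, hjr, hj, hj'⟩ := exists_scale hr (freqSize r⁻¹ ξ)
  refine ⟨j, hjr, hj.imp id And.left, card_image_parent_le hC hr hj' hZ, fun k hk => ?_⟩
  have h1 : ξ ∈ dualBox (2 * C) r⁻¹ (2⁻¹ ^ j) (node r⁻¹ k) :=
    (hZ k hk).2.mem_dualBox hC (inv_pos.2 hr0) (by positivity)
      (hj.imp (fun h => by simp [h]) And.right)
  refine dualBox_subset_dualBox (by linarith) (by norm_num) (by positivity) (by positivity) ?_ h1
  rw [norm_sub_rev]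
  calc (2⁻¹ : ℝ) ^ j * ‖node r⁻¹ k - node (2 ^ j / r) (parent j k)‖
      ≤ 2⁻¹ ^ j * (3 / 2 * (2 ^ j / r)) := by gcongr; exact norm_node_sub_parent_le hr0 j k
    _ = 3 / 2 * r⁻¹ := by rw [inv_pow]; field_simp

section SquaredModulus

/-- The complex conjugate of a Schwartz function. -/
noncomputable def conjSchwartz {E : Type*} [NormedAddCommGroup E] [InnerProductSpace ℝ E]
    (f : 𝓢(E, ℂ)) : 𝓢(E, ℂ) :=
  f.postcompCLM (Complex.conjCLE : ℂ →L[ℝ] ℂ)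

theorem conjSchwartz_apply {E : Type*} [NormedAddCommGroup E] [InnerProductSpace ℝ E]
    (f : 𝓢(E, ℂ)) (x : E) : conjSchwartz f x = star (f x) := rfl

variable {E : Type*} [NormedAddCommGroup E] [InnerProductSpace ℝ E] [FiniteDimensional ℝ E]
  [MeasurableSpace E] [BorelSpace E]

theorem fourier_fourier_apply (h : 𝓢(E, ℂ)) (ξ : E) : 𝓕 (𝓕 h) ξ = h (-ξ) := by
  have h1 : 𝓕⁻ (𝓕 h) (-ξ) = h (-ξ) := by simp
  rw [← h1, SchwartzMap.fourierInv_coe, SchwartzMap.fourier_coe, Real.fourierInv_eq_fourier_neg,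
    neg_neg]

theorem fourierInv_conjSchwartz (f : 𝓢(E, ℂ)) (ξ : E) :
    𝓕⁻ (conjSchwartz f) ξ = star (𝓕 f ξ) := by
  rw [SchwartzMap.fourierInv_coe, SchwartzMap.fourier_coe, Real.fourierInv_eq, Real.fourier_eq]
  change _ = (starRingEnd ℂ) _
  rw [← integral_conj]
  congr 1
  funext x
  rw [Circle.smul_def, Circle.smul_def, smul_eq_mul, smul_eq_mul, map_mul, conjSchwartz_apply,
    AddChar.map_neg_eq_inv, Circle.coe_inv_eq_conj, Complex.conj_conj]
  rfl

/-- The squared modulus of a function with frequencies in `S` has frequencies in `S - S`. -/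
theorem exists_schwartz_norm_sq (m : 𝓢(E, ℂ)) {S : Set E} (hS : ∀ ξ ∉ S, m ξ = 0) :
    ∃ P : 𝓢(E, ℂ), (∀ x, P x = ((‖𝓕⁻ m x‖ ^ 2 : ℝ) : ℂ)) ∧
      ∀ ξ, 𝓕 P ξ ≠ 0 → ∃ a ∈ S, ∃ b ∈ S, ξ = a - b := by
  set f : 𝓢(E, ℂ) := 𝓕⁻ m with hf
  set a : 𝓢(E, ℂ) := 𝓕⁻ f with ha
  set b : 𝓢(E, ℂ) := 𝓕⁻ (conjSchwartz f) with hb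
  have ham : ∀ t, a t = m (-t) := by
    intro t
    have h1 : 𝓕 f (-t) = m (-t) := by simp [hf]
    rw [← h1, ha, SchwartzMap.fourierInv_coe, SchwartzMap.fourier_coe,
      Real.fourierInv_eq_fourier_neg]
  have hbm : ∀ t, b t = star (m t) := by
    intro t
    rw [hb, fourierInv_conjSchwartz, hf]
    simp
  set Q : 𝓢(E, ℂ) := SchwartzMap.convolution (ContinuousLinearMap.mul ℂ ℂ) a b with hQ
  refine ⟨𝓕 Q, fun x => ?_, fun ξ hξ => ?_⟩
  · rw [hQ, SchwartzMap.fourier_convolution, SchwartzMap.pairing_apply_apply, ha, hb]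
    simp only [FourierTransform.fourier_fourierInv_eq, ContinuousLinearMap.mul_apply',
      conjSchwartz_apply]
    rw [Complex.star_def, Complex.mul_conj, Complex.normSq_eq_norm_sq]
  · rw [fourier_fourier_apply, hQ, SchwartzMap.convolution_apply] at hξ
    have hex : ∃ t, ContinuousLinearMap.mul ℂ ℂ (a t) (b (-ξ - t)) ≠ 0 := by
      by_contra! hcon
      exact hξ (by simp only [convolution, hcon, integral_zero])
    obtain ⟨t, ht⟩ := hex
    rw [ContinuousLinearMap.mul_apply', ham, hbm] at ht
    refine ⟨-t, ?_, -ξ - t, ?_, by abel⟩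
    · by_contra h
      exact ht (by rw [hS _ h, zero_mul])
    · by_contra h
      exact ht (by rw [hS _ h, star_zero, mul_zero])

end SquaredModulus

theorem exists_schwartz_fourierPiece {χ : E5 → ℝ} {S : Set E5} (hχ : ContDiff ℝ ∞ χ)
    (hS : Bornology.IsBounded S) (hsupp : tsupport χ ⊆ S) (f : 𝓢(E5, ℂ)) :
    ∃ P : 𝓢(E5, ℂ), (∀ x, P x = ((‖fourierPiece χ f x‖ ^ 2 : ℝ) : ℂ)) ∧
      ∀ ξ, 𝓕 P ξ ≠ 0 → ∃ a ∈ S, ∃ b ∈ S, ξ = a - b := by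
  have hcs : HasCompactSupport χ :=
    HasCompactSupport.of_support_subset_isCompact hS.isCompact_closure
      ((subset_tsupport χ).trans (hsupp.trans subset_closure))
  have hcs' : HasCompactSupport fun ξ => (χ ξ : ℂ) * 𝓕 f ξ :=
    (hcs.comp_left Complex.ofReal_zero).mul_right
  have hsm : ContDiff ℝ ∞ fun ξ => (χ ξ : ℂ) * 𝓕 f ξ :=
    (Complex.ofRealCLM.contDiff.comp hχ).mul ((𝓕 f).smooth _)
  obtain ⟨P, hP, hP'⟩ := exists_schwartz_norm_sq (hcs'.toSchwartzMap hsm) (S := S) fun ξ hξ => by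
    have : χ ξ = 0 := by
      by_contra h
      exact hξ (hsupp (subset_tsupport χ h))
    simp [this]
  refine ⟨P, fun x => ?_, hP'⟩
  rw [hP, SchwartzMap.fourierInv_coe]
  rfl

theorem enorm_sum_eq_sum_enorm_sq {ι : Type*} (Z : Finset ι) (P : ι → 𝓢(E5, ℂ)) (F : ι → E5 → ℂ)
    (hP : ∀ k ∈ Z, ∀ x, P k x = ((‖F k x‖ ^ 2 : ℝ) : ℂ)) (x : E5) :
    ‖(∑ k ∈ Z, P k) x‖ₑ = ∑ k ∈ Z, ‖F k x‖ₑ ^ 2 := by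
  have h1 : (∑ k ∈ Z, P k) x = ((∑ k ∈ Z, ‖F k x‖ ^ 2 : ℝ) : ℂ) := by
    rw [sum_apply, Complex.ofReal_sum]
    exact Finset.sum_congr rfl fun k hk => hP k hk x
  rw [h1, ← ofReal_norm, Complex.norm_real,
    Real.norm_of_nonneg (Finset.sum_nonneg fun _ _ => by positivity),
    ENNReal.ofReal_sum_of_nonneg fun _ _ => by positivity]
  refine Finset.sum_congr rfl fun k _ => ?_
  rw [ENNReal.ofReal_pow (norm_nonneg _), ofReal_norm]

theorem eLpNorm_squareFn_pow_four (d r s : ℝ) (w : ℂ) (χ : ℤ × ℤ → E5 → ℝ) (f : 𝓢(E5, ℂ))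
    (μ : Measure E5) :
    eLpNorm (squareFn d r s w χ f) 2 μ ^ 4 =
      (∫⁻ x, ∑ k ∈ subPlanks d r s w, ‖fourierPiece (χ k) f x‖ₑ ^ 2 ∂μ) ^ 2 := by
  have h1 : eLpNorm (squareFn d r s w χ f) 2 μ ^ 2 =
      ∫⁻ x, ‖squareFn d r s w χ f x‖ₑ ^ 2 ∂μ := by
    have := eLpNorm_nnreal_pow_eq_lintegral (f := squareFn d r s w χ f) (μ := μ) (p := 2)
      (by norm_num)
    norm_num at this
    exact_mod_cast this
  rw [show 4 = 2 * 2 from rfl, pow_mul, h1]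
  congr 1
  refine lintegral_congr fun x => ?_
  have h2 : 0 ≤ ∑ k ∈ subPlanks d r s w, ‖fourierPiece (χ k) f x‖ ^ 2 :=
    Finset.sum_nonneg fun _ _ => by positivity
  rw [squareFn, ← ofReal_norm, Real.norm_of_nonneg (Real.sqrt_nonneg _),
    ← ENNReal.ofReal_pow (Real.sqrt_nonneg _), Real.sq_sqrt h2,
    ENNReal.ofReal_sum_of_nonneg fun _ _ => by positivity]
  refine Finset.sum_congr rfl fun k _ => ?_
  rw [ENNReal.ofReal_pow (norm_nonneg _), ofReal_norm]

/-- The planks inside the plank with index `m` at scale `2 ^ j / r` whose parent it is. -/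
noncomputable def children (d r : ℝ) (j : ℕ) (m : ℤ × ℤ) : Finset (ℤ × ℤ) :=
  (subPlanks d r (2 ^ j / r) (node (2 ^ j / r) m)).filter fun k => parent j k = m

theorem mem_children {d r : ℝ} (hd : 3 ≤ d) (hr : 1 ≤ r) {j : ℕ} (hj : j = 0 ∨ 5 ≤ j)
    (hjr : (2 : ℝ) ^ j / r ≤ 1) {k m : ℤ × ℤ} :
    k ∈ children d r j m ↔ k ∈ grid r⁻¹ ∧ parent j k = m := by
  classical
  constructor
  · intro h
    simp only [children, subPlanks, Finset.mem_filter] at h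
    exact ⟨h.1.1, h.2⟩
  · rintro ⟨hk, rfl⟩
    exact Finset.mem_filter.2 ⟨mem_subPlanks_parent hd hr hj hjr hk, rfl⟩

/-- The pointwise bound on the frequency side. -/
theorem enorm_sq_sum_le_tsum {d r : ℝ} (hd : 3 ≤ d) (hr : 1 ≤ r) (Q : ℤ × ℤ → ℂ) (ξ : E5)
    (hQ : ∀ k ∈ grid r⁻¹, Q k ≠ 0 → NearPlank (130 * d) r⁻¹ ξ (node r⁻¹ k)) :
    ‖∑ k ∈ grid r⁻¹, Q k‖ₑ ^ 2 ≤ parentBound (130 * d) *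
      ∑' j : {j : ℕ // (2 : ℝ) ^ j / r ≤ 1}, ∑ m ∈ grid (2 ^ (j : ℕ) / r),
        (dualBox (2 * (130 * d) * (1 + 3 / 2) ^ 2) r⁻¹ (2⁻¹ ^ (j : ℕ))
          (node (2 ^ (j : ℕ) / r) m)).indicator
            (fun _ => ‖∑ k ∈ children d r j m, Q k‖ₑ ^ 2) ξ := by
  classical
  have hr0 : 0 < r := by linarith
  set Z : Finset (ℤ × ℤ) := (grid r⁻¹).filter fun k => Q k ≠ 0 with hZdef
  have hZ : ∀ k ∈ Z, k ∈ grid r⁻¹ ∧ NearPlank (130 * d) r⁻¹ ξ (node r⁻¹ k) := by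
    intro k hk
    obtain ⟨h1, h2⟩ := Finset.mem_filter.1 hk
    exact ⟨h1, hQ k h1 h2⟩
  obtain ⟨j, hjr, hj, hcard, hbox⟩ := exists_scale_decomposition (by linarith) hr ξ hZ
  have hsum : ∑ k ∈ grid r⁻¹, Q k = ∑ m ∈ Z.image (parent j), ∑ k ∈ children d r j m, Q k := by
    have h1 : ∑ k ∈ grid r⁻¹, Q k = ∑ k ∈ Z, Q k := (Finset.sum_filter_ne_zero _).symm
    rw [h1, ← Finset.sum_fiberwise_of_maps_to (g := parent j) (t := Z.image (parent j))
      fun k hk => Finset.mem_image_of_mem _ hk]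
    refine Finset.sum_congr rfl fun m _ => ?_
    refine Finset.sum_subset (fun k hk => ?_) fun k hk hk' => ?_
    · rw [Finset.mem_filter] at hk
      exact (mem_children hd hr hj hjr).2 ⟨(hZ k hk.1).1, hk.2⟩
    · by_contra h
      obtain ⟨e1, e2⟩ := (mem_children hd hr hj hjr).1 hk
      exact hk' (Finset.mem_filter.2 ⟨Finset.mem_filter.2 ⟨e1, h⟩, e2⟩)
  have hsub : Z.image (parent j) ⊆ grid (2 ^ j / r) := by
    intro m hm
    obtain ⟨k, hk, rfl⟩ := Finset.mem_image.1 hm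
    exact parent_mem_grid hr0 j (hZ k hk).1
  calc ‖∑ k ∈ grid r⁻¹, Q k‖ₑ ^ 2
      ≤ (∑ m ∈ Z.image (parent j), ‖∑ k ∈ children d r j m, Q k‖ₑ) ^ 2 := by
        rw [hsum]; gcongr; exact enorm_sum_le _ _
    _ ≤ (Z.image (parent j)).card *
          ∑ m ∈ Z.image (parent j), ‖∑ k ∈ children d r j m, Q k‖ₑ ^ 2 := ennreal_sq_sum_le _ _
    _ ≤ parentBound (130 * d) * ∑ m ∈ grid (2 ^ j / r),
        (dualBox (2 * (130 * d) * (1 + 3 / 2) ^ 2) r⁻¹ (2⁻¹ ^ j)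
          (node (2 ^ j / r) m)).indicator
            (fun _ => ‖∑ k ∈ children d r j m, Q k‖ₑ ^ 2) ξ := by
        refine mul_le_mul' (Nat.cast_le.2 hcard) ?_
        refine le_trans (le_of_eq ?_) (Finset.sum_le_sum_of_subset hsub)
        refine Finset.sum_congr rfl fun m hm => ?_
        obtain ⟨k, hk, rfl⟩ := Finset.mem_image.1 hm
        rw [Set.indicator_of_mem (hbox k hk)]
    _ ≤ _ := by
        gcongr
        exact ENNReal.le_tsum (f := fun j : {j : ℕ // (2 : ℝ) ^ j / r ≤ 1} =>
          ∑ m ∈ grid (2 ^ (j : ℕ) / r),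
            (dualBox (2 * (130 * d) * (1 + 3 / 2) ^ 2) r⁻¹ (2⁻¹ ^ (j : ℕ))
              (node (2 ^ (j : ℕ) / r) m)).indicator
                (fun _ => ‖∑ k ∈ children d r j m, Q k‖ₑ ^ 2) ξ) ⟨j, hjr⟩

/-- The dual distance constant between dual boxes and wave envelopes. -/
noncomputable def dualConst (d : ℝ) : ℝ := 13 * (2 * (130 * d) * (1 + 3 / 2) ^ 2 * (1 + 14 * d) ^ 2)

/-- The constant of the local estimate over one wave envelope. -/
noncomputable def envelopeConst (d : ℝ) (N : ℕ) : ℝ≥0∞ :=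
  (6 ^ Module.finrank ℝ E5 * N : ℕ) *
    (4 * (12 * ENNReal.ofReal (dualConst d)) ^ (2 * Module.finrank ℝ E5))

theorem envelopeConst_ne_top (d : ℝ) (N : ℕ) : envelopeConst d N ≠ ⊤ :=
  ENNReal.mul_ne_top (ENNReal.natCast_ne_top _) (ENNReal.mul_ne_top (by simp)
    (ENNReal.pow_ne_top (ENNReal.mul_ne_top (by simp) ENNReal.ofReal_ne_top)))

/-- The local estimate over one wave envelope. -/
theorem lintegral_dualBox_le_envelopeSum {d r : ℝ} {N : ℕ} (hd : 3 ≤ d) (hr : 1 ≤ r)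
    {χ : ℤ × ℤ → E5 → ℝ} {f : 𝓢(E5, ℂ)} {P : ℤ × ℤ → 𝓢(E5, ℂ)}
    (hP : ∀ k ∈ grid r⁻¹, ∀ x, P k x = ((‖fourierPiece (χ k) f x‖ ^ 2 : ℝ) : ℂ))
    {j : ℕ} (hjr : (2 : ℝ) ^ j / r ≤ 1) {m : ℤ × ℤ} (hm : m ∈ grid (2 ^ j / r)) {T : Set E5}
    (hT : IsTranslateCover N (waveEnvelope d r (2 ^ j / r) (node (2 ^ j / r) m)) T) :
    ∫⁻ ξ in dualBox (2 * (130 * d) * (1 + 3 / 2) ^ 2) r⁻¹ (2⁻¹ ^ j) (node (2 ^ j / r) m),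
        ‖𝓕 (∑ k ∈ children d r j m, P k) ξ‖ₑ ^ 2 ≤
      envelopeConst d N * envelopeSum d r (2 ^ j / r) (node (2 ^ j / r) m) T χ f := by
  classical
  have hr0 : 0 < r := by linarith
  have hd1 : 1 ≤ d := by linarith
  have hK : 1 ≤ dualConst d := by
    have h1 : (1 : ℝ) ≤ (1 + 14 * d) ^ 2 := one_le_pow₀ (by linarith)
    rw [dualConst]
    nlinarith
  have hts : (2⁻¹ : ℝ) ^ j * (2 ^ j / r) = r⁻¹ := by rw [inv_pow]; field_simp
  refine (lintegral_fourier_sq_le_tsum (convex_convexHull ℝ _) neg_waveEnvelope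
    (isBounded_waveEnvelope hd1 hr)
    (zero_mem_interior_waveEnvelope (subPlanks_nonempty (by linarith) hr j hm)) hT.1 hT.2
    (measurableSet_dualBox _ _ _ _) hK (fun ξ hξ x hx =>
      abs_inner_le_of_mem_waveEnvelope hd1 hr (by positivity) hjr (norm_node_le (by positivity) hm)
        (by positivity) hts (by positivity) (pow_le_one₀ (by norm_num) (by norm_num)) hξ hx) _).trans
    ?_
  rw [envelopeConst]
  refine mul_le_mul' le_rfl (ENNReal.tsum_le_tsum fun x => mul_le_mul' le_rfl ?_)
  rw [eLpNorm_squareFn_pow_four]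
  refine pow_le_pow_left' (lintegral_mono fun y => ?_) 2
  have hgrid : ∀ k ∈ children d r j m, k ∈ grid r⁻¹ := by
    intro k hk
    simp only [children, subPlanks, Finset.mem_filter] at hk
    exact hk.1.1
  rw [enorm_sum_eq_sum_enorm_sq _ P (fun k => fourierPiece (χ k) f) fun k hk => hP k (hgrid k hk)]
  exact Finset.sum_le_sum_of_subset (Finset.filter_subset _ _)

end ComplexCone

open ComplexCone
theorem proposition4p2 (d : ℝ) (hd : 3 ≤ d) (N : ℕ) :
    ∃ C : ℝ≥0, ∀ r : ℝ, 1 ≤ r →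
      ∀ χ : ℤ × ℤ → E5 → ℝ, IsPlankPartition d r χ →
      ∀ T : ℕ → ℤ × ℤ → Set E5,
        (∀ j : ℕ, (2 : ℝ) ^ j / r ≤ 1 → ∀ k ∈ grid ((2 : ℝ) ^ j / r),
          IsTranslateCover N
            (waveEnvelope d r ((2 : ℝ) ^ j / r) (node ((2 : ℝ) ^ j / r) k)) (T j k)) →
      ∀ f : 𝓢(E5, ℂ), tsupport (𝓕 (f : E5 → ℂ)) ⊆ Metric.cthickening (r⁻¹ ^ 2) cone →
        ∫⁻ x, (∑ k ∈ grid r⁻¹, ‖fourierPiece (χ k) f x‖ₑ ^ 2) ^ 2 ≤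
          C * ∑' j : {j : ℕ // (2 : ℝ) ^ j / r ≤ 1}, ∑ k ∈ grid ((2 : ℝ) ^ (j : ℕ) / r),
            envelopeSum d r ((2 : ℝ) ^ (j : ℕ) / r) (node ((2 : ℝ) ^ (j : ℕ) / r) k)
              (T j k) χ f := by
  refine ⟨parentBound (130 * d) * (envelopeConst d N).toNNReal, fun r hr χ hχ T hT f _ => ?_⟩
  have hr0 : 0 < r := by linarith
  have hpiece : ∀ k ∈ grid r⁻¹, ∃ P : 𝓢(E5, ℂ),
      (∀ x, P x = ((‖fourierPiece (χ k) f x‖ ^ 2 : ℝ) : ℂ)) ∧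
        ∀ ξ, 𝓕 P ξ ≠ 0 → NearPlank (130 * d) r⁻¹ ξ (node r⁻¹ k) := by
    intro k hk
    obtain ⟨P, hP, hP'⟩ := exists_schwartz_fourierPiece (hχ.smooth k hk) (isBounded_plank _ _ _)
      (hχ.tsupport_subset k hk) f
    refine ⟨P, hP, fun ξ hξ => ?_⟩
    obtain ⟨a, ha, b, hb, rfl⟩ := hP' ξ hξ
    exact plank_sub_bounds (by linarith) (inv_pos.2 hr0) (inv_le_one_of_one_le₀ hr)
      (norm_node_le (inv_pos.2 hr0) hk) ha hb
  choose! P hP hP' using hpiece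
  have hFsum : ∀ (Z : Finset (ℤ × ℤ)) (ξ : E5), 𝓕 (∑ k ∈ Z, P k) ξ = ∑ k ∈ Z, 𝓕 (P k) ξ := by
    intro Z ξ
    have : 𝓕 (∑ k ∈ Z, P k) = ∑ k ∈ Z, 𝓕 (P k) :=
      map_sum (FourierTransform.fourierCLM ℂ 𝓢(E5, ℂ)) P Z
    rw [this, sum_apply]
  let V : ℕ → ℤ × ℤ → Set E5 := fun j m =>
    dualBox (2 * (130 * d) * (1 + 3 / 2) ^ 2) r⁻¹ (2⁻¹ ^ j) (node (2 ^ j / r) m)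
  have hmeas : ∀ (j : ℕ) (m : ℤ × ℤ), Measurable fun ξ =>
      (V j m).indicator (fun _ => ‖∑ k ∈ children d r j m, 𝓕 (P k) ξ‖ₑ ^ 2) ξ := by
    intro j m
    have h1 : Measurable fun ξ => ‖∑ k ∈ children d r j m, 𝓕 (P k) ξ‖ₑ ^ 2 := by
      have h2 : Continuous fun ξ => ∑ k ∈ children d r j m, 𝓕 (P k) ξ :=
        continuous_finsetSum _ fun k _ => (𝓕 (P k)).continuous
      exact (h2.enorm.measurable).pow_const 2
    exact h1.indicator (measurableSet_dualBox _ _ _ _)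
  calc ∫⁻ x, (∑ k ∈ grid r⁻¹, ‖fourierPiece (χ k) f x‖ₑ ^ 2) ^ 2
      = ∫⁻ x, ‖(∑ k ∈ grid r⁻¹, P k) x‖ₑ ^ 2 := by
        refine lintegral_congr fun x => ?_
        rw [enorm_sum_eq_sum_enorm_sq _ P (fun k => fourierPiece (χ k) f) hP]
    _ = ∫⁻ ξ, ‖∑ k ∈ grid r⁻¹, 𝓕 (P k) ξ‖ₑ ^ 2 := by
        rw [← lintegral_enorm_sq_fourier]
        exact lintegral_congr fun ξ => by rw [hFsum]
    _ ≤ ∫⁻ ξ, parentBound (130 * d) * ∑' j : {j : ℕ // (2 : ℝ) ^ j / r ≤ 1},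
          ∑ m ∈ grid (2 ^ (j : ℕ) / r), (V j m).indicator
            (fun _ => ‖∑ k ∈ children d r j m, 𝓕 (P k) ξ‖ₑ ^ 2) ξ :=
        lintegral_mono fun ξ => enorm_sq_sum_le_tsum hd hr _ ξ fun k hk => hP' k hk ξ
    _ = parentBound (130 * d) * ∑' j : {j : ℕ // (2 : ℝ) ^ j / r ≤ 1},
          ∑ m ∈ grid (2 ^ (j : ℕ) / r), ∫⁻ ξ in V j m,
            ‖𝓕 (∑ k ∈ children d r j m, P k) ξ‖ₑ ^ 2 := by
        rw [lintegral_const_mul' _ _ (ENNReal.natCast_ne_top _), lintegral_tsum]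
        · congr 2
          funext j
          rw [lintegral_finsetSum _ fun m _ => hmeas j m]
          refine Finset.sum_congr rfl fun m _ => ?_
          simp only [hFsum]
          exact lintegral_indicator (measurableSet_dualBox _ _ _ _) _
        · exact fun j => (Finset.measurable_sum _ fun m _ => hmeas j m).aemeasurable
    _ ≤ parentBound (130 * d) * ∑' j : {j : ℕ // (2 : ℝ) ^ j / r ≤ 1},
          ∑ m ∈ grid (2 ^ (j : ℕ) / r), envelopeConst d N *
            envelopeSum d r (2 ^ (j : ℕ) / r) (node (2 ^ (j : ℕ) / r) m) (T j m) χ f := by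
        gcongr with j m hm
        exact lintegral_dualBox_le_envelopeSum hd hr hP j.2 hm (hT j j.2 m hm)
    _ = _ := by
        simp only [← Finset.mul_sum, ENNReal.tsum_mul_left]
        rw [← mul_assoc, ENNReal.coe_mul, ENNReal.coe_toNNReal (envelopeConst_ne_top d N)]
        rfl
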